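/- **Setting.** Let $n\ge 1$, let $S^n$ be the unit sphere in $\mathbb R^{n+1}$ with its standard metric $g_0$ and the associated distance $\operatorname{dist}$, and let $B^{n+1}$ be the open unit ball with the hyperbolic metric $4|dx|^2/(1-|x|^2)^2$. The Möbius (conformal) group of $S^n$ is the group generated by the reflections in linear hyperplanes and the inversions in spheres orthogonal to $S^n$; it acts on $S^n$ and, by hyperbolic isometries, on $B^{n+1}$. A Kleinian group is a discrete group $\Gamma$ of Möbius transformations whose domain of discontinuity $\Omega(\Gamma)\subset S^n$ (the set of points having a neighbourhood that meets only finitely many of its translates) is non-empty. Let $L(\Gamma)=S^n\setminus\Omega(\Gamma)$ be its limit set; $\Gamma$ is nonelementary if $L(\Gamma)$ has more than two points. We assume that $\Gamma$ acts freely on $\Omega(\Gamma)$ (for instance, that $\Gamma$ is torsion-free), so that the Kleinian manifold $\Omega(\Gamma)/\Gamma$ is a smooth manifold with a locally conformally flat structure. For $\epsilon>0$ consider the open balls $B(x,\epsilon\operatorname{dist}(x,L(\Gamma)))$ of $S^n$, $x\in\Omega(\Gamma)$, and all their images $B_\beta$ under $\Gamma$; let $H_\beta\subset B^{n+1}$ be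 the open hyperbolic half-space over $B_\beta$ and let $G_\epsilon(\Gamma)=\partial\big(\bigcup_\beta H_\beta\big)\cap B^{n+1}$. **Theorem.** Let $\Gamma$ be a nonelementary Kleinian group acting freely on $\Omega(\Gamma)$, and suppose that $\Omega(\Gamma)/\Gamma$ is compact. 1. Every smooth Riemannian metric $g$ on $\Omega(\Gamma)/\Gamma$ in the conformal class lifts to a metric $e^{2u}g_0$ on $\Omega(\Gamma)$, with $u$ smooth, which is $\Gamma$-invariant and complete, and there is a constant $K>0$ with $$\frac1K\,\frac1{\operatorname{dist}(x,L(\Gamma))}\le e^{u(x)}\le K\,\frac1{\operatorname{dist}(x,L(\Gamma))}\qquad\text{for all }x\in\Omega(\Gamma).$$ 2. There is $\epsilon_0>0$ (depending on $\Gamma$) such that for every $0<\epsilon<\epsilon_0$ the hypersurface $G_\epsilon(\Gamma)$ is $\Gamma$-invariant and is a Lipschitz graph over $\Omega(\Gamma)$: there is $f:\Omega(\Gamma)\to(0,1)$ with $|f(x)-f(y)|\le M\operatorname{dist}(x,y)$ for some $M$ and all $x,y$, such that $F(x)=f(x)\,x$ is a bijection of $\Omega(\Gamma)$ onto $G_\epsilon(\Gamma)$.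 Moreover, for every metric $g$ as in 1, the map $F$ is bi-Lipschitz from $\Omega(\Gamma)$ with the distance of the lifted metric $e^{2u}g_0$ onto $G_\epsilon(\Gamma)$ with the length distance induced by the hyperbolic metric: for some $\Lambda>0$ and all $x,y\in\Omega(\Gamma)$, $$d_G(F(x),F(y))\le\Lambda\, d_u(x,y),\qquad d_u(x,y)\le\Lambda\, d_G(F(x),F(y)).$$ Here distances are infima of lengths of Lipschitz curves in the space concerned, with value $\infty$ if two points cannot be joined. -/

import Mathlib

open Set Filter Metric Topology MeasureTheory
open scoped Manifold ContDiff ENNReal NNReal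

noncomputable section

/-! ### The unit sphere, the unit ball, and the Möbius group -/

/-- Euclidean space of dimension `n + 1`, which contains the unit sphere of dimension `n` and the
unit ball bounded by it. -/
abbrev ESpace (n : ℕ) : Type := EuclideanSpace ℝ (Fin (n + 1))

/-- The unit sphere `S^n`, with the smooth structure that Mathlib puts on it. -/
abbrev USphere (n : ℕ) : Type := sphere (0 : ESpace n) 1

/-- The open unit ball `B^{n+1}`. -/
abbrev UBall (n : ℕ) : Type := ball (0 : ESpace n) 1

/-- The reflections of the closed unit ball: the reflection in a linear hyperplane, and the
inversion in a Euclidean sphere that is orthogonal to the unit sphere (a sphere with centre `a`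
is orthogonal to the unit sphere when its radius is `√(‖a‖² - 1)`). -/
def IsBallReflection {n : ℕ} (R : ESpace n → ESpace n) : Prop :=
  (∃ v : ESpace n, v ≠ 0 ∧ ∀ x, R x = (Submodule.span ℝ {v})ᗮ.reflection x) ∨
    ∃ a : ESpace n, 1 < ‖a‖ ∧ ∀ x, R x = EuclideanGeometry.inversion a (√(‖a‖ ^ 2 - 1)) x

/-- The Möbius group of the closed unit ball, generated by the reflections. An element is recorded
as the pair of its restriction to the sphere and its restriction to the open ball. -/
def moebiusPairs (n : ℕ) : Subgroup ((USphere n ≃ₜ USphere n) × Equiv.Perm (UBall n)) :=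
  Subgroup.closure {p | ∃ R : ESpace n → ESpace n, IsBallReflection R ∧
    (∀ x, (p.1 x : ESpace n) = R x) ∧ ∀ z, (p.2 z : ESpace n) = R z}

/-- The group of Möbius (conformal) transformations of the sphere `S^n`. -/
def moebiusGroup (n : ℕ) : Subgroup (USphere n ≃ₜ USphere n) :=
  (moebiusPairs n).map (MonoidHom.fst _ _)

/-- `τ` is the action on the ball (a hyperbolic isometry) of the Möbius transformation `γ` of the
sphere. -/
def IsPoincareExtension {n : ℕ} (γ : USphere n ≃ₜ USphere n) (τ : Equiv.Perm (UBall n)) : Prop :=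
  (γ, τ) ∈ moebiusPairs n

theorem contMDiff_of_isBallReflection {n : ℕ} {R : ESpace n → ESpace n} (hR : IsBallReflection R)
    (f : USphere n → USphere n) (hf : ∀ x, (f x : ESpace n) = R x) :
    ContMDiff (𝓡 n) (𝓡 n) ∞ f := by
  have : Fact (Module.finrank ℝ (ESpace n) = n + 1) := ⟨by simp⟩
  have key : ContMDiff (𝓡 n) 𝓘(ℝ, ESpace n) ∞ (fun x : USphere n => R x) := by
    intro x
    have hx : ContDiffAt ℝ ∞ R (x : ESpace n) := by
      rcases hR with ⟨v, -, h⟩ | ⟨a, ha, h⟩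
      · have : R = fun x => (Submodule.span ℝ {v})ᗮ.reflection x := funext h
        rw [this]
        exact ((Submodule.span ℝ {v})ᗮ.reflection).contDiff.contDiffAt
      · have : R = fun x => EuclideanGeometry.inversion a (√(‖a‖ ^ 2 - 1)) x := funext h
        rw [this]
        refine ContDiffAt.inversion contDiffAt_const contDiffAt_const contDiffAt_id ?_
        rintro hxa
        have h1 : ‖(x : ESpace n)‖ = 1 := by simp
        have h2 : (x : ESpace n) = a := hxa
        rw [h2] at h1
        linarith
    exact hx.contMDiffAt.comp x (contMDiff_coe_sphere (n := n) x)
  have h2 := ContMDiff.codRestrict_sphere (n := n) key (fun x => by rw [← hf]; exact (f x).2)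
  have h3 : Set.codRestrict (fun x : USphere n => R x) (sphere (0 : ESpace n) 1)
      (fun x => by rw [← hf]; exact (f x).2) = f := funext fun x => Subtype.ext (hf x).symm
  rw [h3] at h2
  exact h2

/-- Möbius transformations of the sphere are smooth. -/
theorem contMDiff_of_mem_moebiusGroup {n : ℕ} {γ : USphere n ≃ₜ USphere n}
    (hγ : γ ∈ moebiusGroup n) : ContMDiff (𝓡 n) (𝓡 n) ∞ γ := by
  obtain ⟨p, hp, rfl⟩ := hγ
  suffices h : ContMDiff (𝓡 n) (𝓡 n) ∞ p.1 ∧ ContMDiff (𝓡 n) (𝓡 n) ∞ (p.1⁻¹ : USphere n ≃ₜ USphere n)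
    from h.1
  induction hp using Subgroup.closure_induction with
  | mem p hp =>
    obtain ⟨R, hR, h1, -⟩ := hp
    refine ⟨contMDiff_of_isBallReflection hR _ h1,
      contMDiff_of_isBallReflection hR _ fun x => ?_⟩
    have hinv : ∀ y : ESpace n, R (R y) = y := by
      intro y
      rcases hR with ⟨v, -, h⟩ | ⟨a, ha, h⟩
      · simp [h]
      · rw [h, h]
        apply EuclideanGeometry.inversion_inversion
        have : 0 < ‖a‖ ^ 2 - 1 := by nlinarith
        positivity
    have h3 : p.1 (p.1⁻¹ x) = x := p.1.apply_symm_apply x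
    conv_rhs => rw [← h3]
    rw [h1, hinv]
  | one => exact ⟨contMDiff_id, contMDiff_id⟩
  | mul p q _ _ hp hq =>
    refine ⟨hp.1.comp hq.1, ?_⟩
    have : ((p * q).1⁻¹ : USphere n ≃ₜ USphere n) = q.1⁻¹ * p.1⁻¹ := by simp
    rw [this]
    exact hq.2.comp hp.2
  | inv p _ hp => exact ⟨hp.2, by simpa using hp.1⟩

/-! ### Kleinian groups -/

/-- The domain of discontinuity `Ω(Γ)`: the points of the sphere that have a neighbourhood meeting
only finitely many of its translates. -/
def regularSet {n : ℕ} (Γ : Subgroup (USphere n ≃ₜ USphere n)) : Set (USphere n) :=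
  {x | ∃ U ∈ 𝓝 x, {γ | γ ∈ Γ ∧ (γ '' U ∩ U).Nonempty}.Finite}

theorem isOpen_regularSet {n : ℕ} (Γ : Subgroup (USphere n ≃ₜ USphere n)) :
    IsOpen (regularSet Γ) := by
  rw [isOpen_iff_mem_nhds]
  rintro x ⟨U, hU, hfin⟩
  filter_upwards [interior_mem_nhds.2 hU] with y hy
  exact ⟨U, mem_interior_iff_mem_nhds.1 hy, hfin⟩

theorem regularSet_invariant {n : ℕ} {Γ : Subgroup (USphere n ≃ₜ USphere n)}
    {γ : USphere n ≃ₜ USphere n} (hγ : γ ∈ Γ) {x : USphere n} (hx : x ∈ regularSet Γ) :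
    γ x ∈ regularSet Γ := by
  obtain ⟨U, hU, hfin⟩ := hx
  refine ⟨γ '' U, γ.isOpenMap.image_mem_nhds hU, ?_⟩
  refine (hfin.image fun δ => γ * δ * γ⁻¹).subset ?_
  rintro δ ⟨hδ, z, ⟨_, ⟨y, hy, rfl⟩, hyz⟩, w, hw, hwz⟩
  refine ⟨γ⁻¹ * δ * γ, ⟨Γ.mul_mem (Γ.mul_mem (Γ.inv_mem hγ) hδ) hγ, w, ⟨y, hy, ?_⟩, hw⟩, ?_⟩
  · change γ.symm (δ (γ y)) = w
    rw [hyz, ← hwz, γ.symm_apply_apply]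
  · group

/-- A Kleinian group on `S^n`: a discrete group of Möbius transformations (the identity is isolated
for uniform convergence) with non-empty domain of discontinuity, on which it acts freely, so that
the quotient is a manifold. Torsion-free groups act freely, see
`fixedPointFree_of_torsionFree`. -/
structure KleinianGroup (n : ℕ) where
  /-- the underlying group of transformations of the sphere -/
  group : Subgroup (USphere n ≃ₜ USphere n)
  le_moebius : group ≤ moebiusGroup n
  discrete : ∃ δ > 0, ∀ γ ∈ group, (∀ x, dist (γ x) x < δ) → γ = 1
  regularSet_nonempty : (regularSet group).Nonempty
  free : ∀ γ ∈ group, ∀ x ∈ regularSet group, γ x = x → γ = 1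

theorem fixedPointFree_of_torsionFree {n : ℕ} (Γ : Subgroup (USphere n ≃ₜ USphere n))
    (h : ∀ γ ∈ Γ, IsOfFinOrder γ → γ = 1) :
    ∀ γ ∈ Γ, ∀ x ∈ regularSet Γ, γ x = x → γ = 1 := by
  rintro γ hγ x ⟨U, hU, hfin⟩ hx
  refine h γ hγ ?_
  have hpow : ∀ k : ℕ, (γ ^ k) x = x := by
    intro k
    induction k with
    | zero => rfl
    | succ k ih =>
      rw [pow_succ]
      change (γ ^ k) (γ x) = x
      rw [hx, ih]
  by_contra hord
  have hinj : Function.Injective fun k : ℕ => γ ^ k :=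
    injective_pow_iff_not_isOfFinOrder.2 hord
  refine (Set.infinite_range_of_injective hinj) (hfin.subset ?_)
  rintro _ ⟨k, rfl⟩
  exact ⟨Γ.pow_mem hγ k, x, ⟨x, mem_of_mem_nhds hU, hpow k⟩, mem_of_mem_nhds hU⟩

namespace KleinianGroup

variable {n : ℕ} (Γ : KleinianGroup n)

/-- The domain of discontinuity `Ω(Γ)`, an open submanifold of the sphere. -/
def Omega : TopologicalSpace.Opens (USphere n) := ⟨regularSet Γ.group, isOpen_regularSet _⟩

/-- The limit set `L(Γ)`, the complement of the domain of discontinuity. -/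
def limitSet : Set (USphere n) := (regularSet Γ.group)ᶜ

/-- `Γ` is nonelementary: its limit set has more than two points. -/
def IsNonelementary : Prop := 2 < Γ.limitSet.encard

instance : MulAction Γ.group Γ.Omega where
  smul γ x := ⟨γ.1 x.1, regularSet_invariant γ.2 x.2⟩
  one_smul _ := rfl
  mul_smul _ _ _ := rfl

theorem coe_smul (γ : Γ.group) (x : Γ.Omega) : ((γ • x : Γ.Omega) : USphere n) = γ.1 x.1 := rfl

/-- The Kleinian manifold `Ω(Γ)/Γ`, with the quotient topology. -/
def Manifold : Type := MulAction.orbitRel.Quotient Γ.group Γ.Omega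

instance : TopologicalSpace Γ.Manifold :=
  inferInstanceAs (TopologicalSpace (Quotient (MulAction.orbitRel Γ.group Γ.Omega)))

/-- The projection `Ω(Γ) → Ω(Γ)/Γ`. -/
def proj (x : Γ.Omega) : Γ.Manifold := Quotient.mk (MulAction.orbitRel Γ.group Γ.Omega) x

instance : ContinuousConstSMul Γ.group Γ.Omega where
  continuous_const_smul γ :=
    Continuous.subtype_mk (γ.1.continuous.comp continuous_subtype_val) _

theorem contMDiff_smul (γ : Γ.group) :
    ContMDiff (𝓡 n) (𝓡 n) ∞ (fun x : Γ.Omega => γ • x) := by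
  rw [← ContMDiff.subtypeVal_comp_iff]
  exact (contMDiff_of_mem_moebiusGroup (Γ.le_moebius γ.2)).comp contMDiff_subtype_val

theorem exists_disjoint_nhds (x : Γ.Omega) :
    ∃ U ∈ 𝓝 x, ∀ γ : Γ.group, ((γ • ·) '' U ∩ U).Nonempty → γ = 1 := by
  obtain ⟨U, hU, hfin⟩ := x.2
  have hU' : (Subtype.val ⁻¹' U : Set Γ.Omega) ∈ 𝓝 x :=
    continuous_subtype_val.continuousAt.preimage_mem_nhds hU
  have hfin' : {γ : Γ.group | (γ.1 '' U ∩ U).Nonempty}.Finite :=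
    Set.Finite.of_finite_image (f := Subtype.val)
      (hfin.subset (by rintro _ ⟨γ, hγ, rfl⟩; exact ⟨γ.2, hγ⟩)) Subtype.val_injective.injOn
  have hsep : ∀ γ : Γ.group, ∃ V ∈ 𝓝 x, γ ≠ 1 → Disjoint ((γ • ·) '' V) V := by
    intro γ
    by_cases h1 : γ = 1
    · exact ⟨univ, univ_mem, fun h => (h h1).elim⟩
    have hne : γ • x ≠ x := fun h =>
      h1 (Subtype.ext (Γ.free γ.1 γ.2 x.1 x.2 (congrArg Subtype.val h)))
    obtain ⟨A, B, hA, hB, hxA, hxB, hAB⟩ := t2_separation hne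
    have hA' : (γ • ·) ⁻¹' A ∈ 𝓝 x :=
      (continuous_const_smul γ).continuousAt.preimage_mem_nhds (hA.mem_nhds hxA)
    refine ⟨(γ • ·) ⁻¹' A ∩ B, inter_mem hA' (hB.mem_nhds hxB), fun _ => ?_⟩
    refine hAB.mono ?_ inter_subset_right
    rintro _ ⟨y, hy, rfl⟩
    exact hy.1
  choose V hV hVd using hsep
  refine ⟨Subtype.val ⁻¹' U ∩ ⋂ γ ∈ {γ : Γ.group | (γ.1 '' U ∩ U).Nonempty}, V γ,
    inter_mem hU' ((Filter.biInter_mem hfin').2 fun γ _ => hV γ), ?_⟩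
  rintro γ ⟨_, ⟨y, hy, rfl⟩, hz⟩
  have hmem : γ ∈ {γ : Γ.group | (γ.1 '' U ∩ U).Nonempty} := ⟨γ.1 y.1, ⟨y.1, hy.1, rfl⟩, hz.1⟩
  by_contra h1
  exact (Set.disjoint_left.1 (hVd γ h1)) ⟨y, mem_iInter₂.1 hy.2 γ hmem, rfl⟩
    (mem_iInter₂.1 hz.2 γ hmem)

theorem isQuotientCoveringMap_proj : IsQuotientCoveringMap Γ.proj Γ.group where
  toIsQuotientMap := isQuotientMap_quotient_mk'
  toContinuousConstSMul := inferInstance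
  apply_eq_iff_mem_orbit := Quotient.eq''
  disjoint := Γ.exists_disjoint_nhds

theorem isLocalHomeomorph_proj : IsLocalHomeomorph Γ.proj :=
  Γ.isQuotientCoveringMap_proj.isCoveringMap.isLocalHomeomorph

/-- The charts of the Kleinian manifold are the charts of `Ω(Γ)` composed with the local inverses of
the projection. -/
instance : ChartedSpace (EuclideanSpace ℝ (Fin n)) Γ.Manifold :=
  Γ.isLocalHomeomorph_proj.chartedSpace Γ.isQuotientCoveringMap_proj.surjective

/-- Two lifts of the same map differ, locally, by an element of the group. -/
theorem eventually_eq_smul {f : Γ.Omega → Γ.Omega} {x : Γ.Omega} (hf : ContinuousAt f x)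
    (h : ∀ᶠ y in 𝓝 x, Γ.proj (f y) = Γ.proj y) : ∃ γ : Γ.group, f =ᶠ[𝓝 x] fun y => γ • y := by
  obtain ⟨γ, hγ⟩ := Γ.isQuotientCoveringMap_proj.apply_eq_iff_mem_orbit.1 h.self_of_nhds
  change γ • x = f x at hγ
  obtain ⟨U, hU, hUd⟩ := Γ.exists_disjoint_nhds (f x)
  refine ⟨γ, ?_⟩
  have hγU : ∀ᶠ y in 𝓝 x, γ • y ∈ U :=
    (continuous_const_smul γ).continuousAt.preimage_mem_nhds (by rw [hγ]; exact hU)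
  filter_upwards [h, hf hU, hγU] with y h1 h2 h3
  have h4 : Γ.proj (f y) = Γ.proj (γ • y) := by
    rw [h1, Γ.isQuotientCoveringMap_proj.map_smul]
  obtain ⟨δ, hδ⟩ := Γ.isQuotientCoveringMap_proj.apply_eq_iff_mem_orbit.1 h4
  change δ • γ • y = f y at hδ
  have := hUd δ ⟨f y, ⟨γ • y, h3, hδ⟩, h2⟩
  rw [← hδ, this, one_smul]

instance : IsManifold (𝓡 n) ∞ Γ.Manifold := by
  apply isManifold_of_contDiffOn
  rintro _ _ ⟨q, rfl⟩ ⟨q', rfl⟩ p hp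
  set x : Γ.Omega := Γ.isQuotientCoveringMap_proj.surjective.hasRightInverse.choose q with hx
  set x' : Γ.Omega := Γ.isQuotientCoveringMap_proj.surjective.hasRightInverse.choose q' with hx'
  set l := Γ.isLocalHomeomorph_proj.localInverseAt x with hl
  set l' := Γ.isLocalHomeomorph_proj.localInverseAt x' with hl'
  set c := chartAt (EuclideanSpace ℝ (Fin n)) x with hc
  set c' := chartAt (EuclideanSpace ℝ (Fin n)) x' with hc'
  have hls : ∀ z, l.symm z = Γ.proj z := fun z => by
    rw [hl, IsLocalHomeomorph.localInverseAt_symm]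
  have hls' : ∀ z, l'.symm z = Γ.proj z := fun z => by
    rw [hl', IsLocalHomeomorph.localInverseAt_symm]
  simp only [mfld_simps, hls] at hp
  obtain ⟨⟨hp1, hp2⟩, hp3, hp4⟩ := hp
  set y : Γ.Omega := c.symm p with hy
  have hfc : ContinuousAt (fun z => l' (Γ.proj z)) y :=
    (l'.continuousAt hp3).comp Γ.isLocalHomeomorph_proj.continuous.continuousAt
  have hev : ∀ᶠ z in 𝓝 y, Γ.proj (l' (Γ.proj z)) = Γ.proj z := by
    have : ∀ᶠ z in 𝓝 y, Γ.proj z ∈ l'.source :=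
      Γ.isLocalHomeomorph_proj.continuous.continuousAt.preimage_mem_nhds
        (l'.open_source.mem_nhds hp3)
    filter_upwards [this] with z hz
    rw [← hls', l'.left_inv hz]
  obtain ⟨γ, hγ⟩ := Γ.eventually_eq_smul hfc hev
  have hγy : l' (Γ.proj y) = γ • y := hγ.self_of_nhds
  have hcs : ContMDiffAt (𝓡 n) (𝓡 n) ∞ c.symm p :=
    (contMDiffOn_chart_symm (x := x)).contMDiffAt (c.open_target.mem_nhds hp1)
  have hc's : ContMDiffAt (𝓡 n) (𝓡 n) ∞ c' (γ • y) :=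
    (contMDiffOn_chart (x := x')).contMDiffAt (c'.open_source.mem_nhds (by rw [← hγy]; exact hp4))
  have hsm : ContMDiffAt (𝓡 n) (𝓡 n) ∞ (fun z => c' (γ • c.symm z)) p :=
    hc's.comp p ((Γ.contMDiff_smul γ y).comp p hcs)
  refine ContDiffAt.contDiffWithinAt ?_
  refine hsm.contDiffAt.congr_of_eventuallyEq ?_
  filter_upwards [hcs.continuousAt.eventually hγ] with z hz
  simp only [mfld_simps, hls]
  exact congrArg c' hz

/-- The projection onto the Kleinian manifold is smooth. -/
theorem contMDiff_proj : ContMDiff (𝓡 n) (𝓡 n) ∞ Γ.proj := by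
  intro x
  set x' : Γ.Omega :=
    Γ.isQuotientCoveringMap_proj.surjective.hasRightInverse.choose (Γ.proj x) with hx'
  set l' := Γ.isLocalHomeomorph_proj.localInverseAt x' with hl'
  set c' := chartAt (EuclideanSpace ℝ (Fin n)) x' with hc'
  have hls' : ∀ z, l'.symm z = Γ.proj z := fun z => by
    rw [hl', IsLocalHomeomorph.localInverseAt_symm]
  have hchart : chartAt (EuclideanSpace ℝ (Fin n)) (Γ.proj x) = l'.trans c' := rfl
  have hsrc := mem_chart_source (EuclideanSpace ℝ (Fin n)) (Γ.proj x)
  rw [hchart] at hsrc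
  simp only [mfld_simps] at hsrc
  obtain ⟨hp3, hp4⟩ := hsrc
  have hfc : ContinuousAt (fun z => l' (Γ.proj z)) x :=
    (l'.continuousAt hp3).comp Γ.isLocalHomeomorph_proj.continuous.continuousAt
  have hev : ∀ᶠ z in 𝓝 x, Γ.proj (l' (Γ.proj z)) = Γ.proj z := by
    have : ∀ᶠ z in 𝓝 x, Γ.proj z ∈ l'.source :=
      Γ.isLocalHomeomorph_proj.continuous.continuousAt.preimage_mem_nhds
        (l'.open_source.mem_nhds hp3)
    filter_upwards [this] with z hz
    rw [← hls', l'.left_inv hz]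
  obtain ⟨γ, hγ⟩ := Γ.eventually_eq_smul hfc hev
  have hγx : l' (Γ.proj x) = γ • x := hγ.self_of_nhds
  rw [contMDiffAt_iff_target]
  refine ⟨Γ.isLocalHomeomorph_proj.continuous.continuousAt, ?_⟩
  have hc's : ContMDiffAt (𝓡 n) (𝓡 n) ∞ c' (γ • x) :=
    (contMDiffOn_chart (x := x')).contMDiffAt (c'.open_source.mem_nhds (by rw [← hγx]; exact hp4))
  refine (hc's.comp x (Γ.contMDiff_smul γ x)).congr_of_eventuallyEq ?_
  filter_upwards [hγ] with z hz
  simp only [mfld_simps, hchart, extChartAt]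
  exact congrArg c' hz

/-! ### Conformal metrics -/

/-- The inclusion of `Ω(Γ)` in Euclidean space. -/
def incl (x : Γ.Omega) : ESpace n := ((x : USphere n) : ESpace n)

/-- The standard metric `g₀` of the sphere, on `Ω(Γ)`. -/
def roundMetric (x : Γ.Omega) (a b : TangentSpace (𝓡 n) x) : ℝ :=
  inner ℝ (mvfderiv (𝓡 n) Γ.incl x a) (mvfderiv (𝓡 n) Γ.incl x b)

/-- The metric `e^{2u} g₀` on `Ω(Γ)`. -/
def conformalMetric (u : Γ.Omega → ℝ) (x : Γ.Omega) (a b : TangentSpace (𝓡 n) x) : ℝ :=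
  Real.exp (2 * u x) * Γ.roundMetric x a b

/-- The smooth Riemannian metrics on the Kleinian manifold. -/
abbrev RiemannianMetric : Type :=
  Bundle.ContMDiffRiemannianMetric (𝓡 n) ∞ (EuclideanSpace ℝ (Fin n))
    (fun p : Γ.Manifold => TangentSpace (𝓡 n) p)

/-- The pullback to `Ω(Γ)` of a Riemannian metric on the Kleinian manifold. -/
def pullback (g : Γ.RiemannianMetric) (x : Γ.Omega) (a b : TangentSpace (𝓡 n) x) : ℝ :=
  g.inner (Γ.proj x) (mfderiv (𝓡 n) (𝓡 n) Γ.proj x a) (mfderiv (𝓡 n) (𝓡 n) Γ.proj x b)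

/-- `g` belongs to the conformal class of the locally conformally flat structure of the Kleinian
manifold: near every point, read through the local inverses of the projection, `g` has the form
`e^{2w} g₀` with `w` smooth. -/
def IsConformal (g : Γ.RiemannianMetric) : Prop :=
  ∀ x : Γ.Omega, ∃ U ∈ 𝓝 x, ∃ w : Γ.Omega → ℝ, ContMDiffOn (𝓡 n) 𝓘(ℝ) ∞ w U ∧
    ∀ y ∈ U, ∀ a b, Γ.pullback g y a b = Γ.conformalMetric w y a b

/-- The lift of `g` to `Ω(Γ)` is `e^{2u} g₀`. -/
def IsLift (g : Γ.RiemannianMetric) (u : Γ.Omega → ℝ) : Prop :=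
  ∀ x a b, Γ.pullback g x a b = Γ.conformalMetric u x a b

/-- Every element of `Γ` is an isometry of `e^{2u} g₀`. -/
def IsInvariantMetric (u : Γ.Omega → ℝ) : Prop :=
  ∀ (γ : Γ.group) (x : Γ.Omega) (a b : TangentSpace (𝓡 n) x),
    Γ.conformalMetric u (γ • x) (mfderiv (𝓡 n) (𝓡 n) (fun y : Γ.Omega => γ • y) x a)
      (mfderiv (𝓡 n) (𝓡 n) (fun y : Γ.Omega => γ • y) x b) = Γ.conformalMetric u x a b

end KleinianGroup

/-- The length distance on a space `X` mapped to Euclidean space by `ι`, for the length element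
`ρ |dx|`: the infimum of `∫ ρ(c) |c'| dt` over the Lipschitz curves `c : [0, 1] → X` from `p` to `q`.
It is `∞` if there are no such curves. (A curve on `[0, 1]` is given by an extension to the line, for
instance a constant one to the left and to the right.) -/
def lengthEDist {n : ℕ} {X : Type*} (ι : X → ESpace n) (ρ : X → ℝ) (p q : X) : ℝ≥0∞ :=
  ⨅ (c : ℝ → X) (_ : ∃ K : ℝ≥0, LipschitzWith K (ι ∘ c)) (_ : c 0 = p) (_ : c 1 = q),
    ∫⁻ t in Icc (0 : ℝ) 1, ENNReal.ofReal (ρ (c t) * ‖deriv (ι ∘ c) t‖)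

namespace KleinianGroup

variable {n : ℕ} (Γ : KleinianGroup n)

/-- The distance of the metric `e^{2u} g₀` on `Ω(Γ)`. -/
def conformalEDist (u : Γ.Omega → ℝ) (p q : Γ.Omega) : ℝ≥0∞ :=
  lengthEDist Γ.incl (fun x => Real.exp (u x)) p q

/-- The metric `e^{2u} g₀` on `Ω(Γ)` is complete: Cauchy sequences converge. -/
def IsCompleteMetric (u : Γ.Omega → ℝ) : Prop :=
  ∀ x : ℕ → Γ.Omega,
    (∀ ε : ℝ≥0∞, 0 < ε → ∃ N, ∀ i ≥ N, ∀ j ≥ N, Γ.conformalEDist u (x i) (x j) < ε) →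
      ∃ y, Tendsto (fun i => Γ.conformalEDist u (x i) y) atTop (𝓝 0)

end KleinianGroup

/-! ### The invariant graph -/

/-- The distance of the standard metric of the sphere. -/
def sphereDist {n : ℕ} (x y : USphere n) : ℝ :=
  InnerProductGeometry.angle (x : ESpace n) (y : ESpace n)

/-- The open ball of the sphere with centre `c` and radius `r`. -/
def cap {n : ℕ} (c : USphere n) (r : ℝ) : Set (USphere n) := {y | sphereDist c y < r}

/-- The open hyperbolic half-space over the ball `cap c r`, where `0 < r < π`. It is the part of the
unit ball that is cut off by the sphere (for `r = π / 2`, the hyperplane) orthogonal to the unit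
sphere along the boundary of `cap c r`; this sphere has centre `c / cos r` and radius `|tan r|`. -/
def halfSpace {n : ℕ} (c : USphere n) (r : ℝ) : Set (ESpace n) :=
  {z | ‖z‖ < 1 ∧ Real.cos r * (1 + ‖z‖ ^ 2) < 2 * inner ℝ (c : ESpace n) z}

namespace KleinianGroup

variable {n : ℕ} (Γ : KleinianGroup n)

/-- The spherical distance to the limit set. -/
def distLimit (x : Γ.Omega) : ℝ := ⨅ y : Γ.limitSet, sphereDist (x : USphere n) y

/-- The balls `B(x, ε · dist(x, L(Γ)))` with `x ∈ Ω(Γ)`, and all their images under `Γ`; a ball is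
given by its centre and its radius. -/
def ballFamily (ε : ℝ) : Set (USphere n × ℝ) :=
  {p | 0 < p.2 ∧ p.2 < Real.pi ∧ ∃ x : Γ.Omega, ∃ γ ∈ Γ.group,
    γ '' cap (x : USphere n) (ε * Γ.distLimit x) = cap p.1 p.2}

/-- The hypersurface `G(Γ)`: the part in the open unit ball of the boundary of the union of the
half-spaces over the balls of the family. -/
def graph (ε : ℝ) : Set (ESpace n) :=
  frontier (⋃ p ∈ Γ.ballFamily ε, halfSpace p.1 p.2) ∩ ball 0 1

/-- The distance on `G(Γ)` induced by the hyperbolic metric `2 |dx| / (1 - |x|²)` of the ball: the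
infimum of the hyperbolic lengths of curves on `G(Γ)`. -/
def graphEDist (ε : ℝ) (p q : Γ.graph ε) : ℝ≥0∞ :=
  lengthEDist (fun z : Γ.graph ε => (z : ESpace n))
    (fun z : Γ.graph ε => 2 / (1 - ‖(z : ESpace n)‖ ^ 2)) p q

end KleinianGroup

end

/-! ### Spherical and chordal distance -/

section Sphere

variable {n : ℕ}

/-! Every quantity is compared with `gap`, the chordal distance to the limit set.

A Möbius map γ distorts chords by |γx − γy|² = j(x) j(y) |x − y|², where j is its `factor`, so a
triangle x, y, z determines j(x) (`factor_mul_dist`). Taking y and z in the limit set, which Γ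
preserves, shows that j is a cocycle, that j(x)·gap(x) is bounded over all γ and x, and that for d
in a compact set j(d) is comparable with gap(γd), uniformly in γ
(`exists_factor_comparable_of_isCompact`). By cocompactness a compact set meets every orbit.

Metrics: the lift e^{2u}g₀ is invariant, that is, e^{u(γx)} j(x) = e^{u(x)}. As u is bounded on a
compact set meeting all orbits, e^u is comparable with 1/gap. A short curve for such a length
element moves a point by only a small fraction of its gap, and completeness follows.

Graph: the same comparison shows that a cap of the family has radius at most Cε·gap at each of its
points. The half-space over the cap (c, r) is 1 + |z|² < 2⟨c, z⟩/cos r, so the union is governed by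
the positively homogeneous function h(z) = sup ⟨c, z⟩/cos r. On the ray through a point x of the
sphere, with a = h(x), the boundary is t² − 2at + 1 = 0. It has a root in (0, 1) exactly when a > 1,
that is, when some cap contains x, that is, over Ω; the root is f = a − √(a² − 1). The ball centred
at x gives √(a² − 1) ≥ ε·gap, and a varies with a Lipschitz constant of order Cε·gap
(`level_sub_le`); the gaps cancel and f is Lipschitz. Moreover 1 − f² is comparable with gap. Hence
F is bi-Lipschitz for Euclidean distances, the densities e^u and 2/(1 − |z|²) are both comparable
with 1/gap, and lengths of curves compare (`lengthEDist_map_le`).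

Invariance: in the hyperboloid model reflections act linearly, so a cap and the half-space over it,
given by one Lorentz vector, are moved together (`exists_cap_image`). -/

theorem USphere.norm_eq (x : USphere n) : ‖(x : ESpace n)‖ = 1 := by simp

theorem cos_sphereDist (x y : USphere n) :
    Real.cos (sphereDist x y) = inner ℝ (x : ESpace n) y := by
  simp [sphereDist, InnerProductGeometry.cos_angle]

theorem sphereDist_nonneg (x y : USphere n) : 0 ≤ sphereDist x y :=
  InnerProductGeometry.angle_nonneg _ _

theorem sphereDist_le_pi (x y : USphere n) : sphereDist x y ≤ Real.pi :=
  InnerProductGeometry.angle_le_pi _ _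

theorem USphere.dist_sq (x y : USphere n) :
    dist x y ^ 2 = 2 - 2 * inner ℝ (x : ESpace n) y := by
  rw [Subtype.dist_eq, dist_eq_norm, norm_sub_sq_real, USphere.norm_eq, USphere.norm_eq]
  ring

theorem dist_eq_two_mul_sin (x y : USphere n) :
    dist x y = 2 * Real.sin (sphereDist x y / 2) := by
  have h1 := sphereDist_nonneg x y
  have h2 := sphereDist_le_pi x y
  have hs : 0 ≤ Real.sin (sphereDist x y / 2) :=
    Real.sin_nonneg_of_nonneg_of_le_pi (by linarith) (by linarith)
  refine (pow_left_inj₀ dist_nonneg (by positivity) two_ne_zero).1 ?_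
  rw [USphere.dist_sq, ← cos_sphereDist, mul_pow, Real.sin_sq_eq_half_sub]
  rw [show 2 * (sphereDist x y / 2) = sphereDist x y by ring]
  ring

theorem dist_le_sphereDist (x y : USphere n) : dist x y ≤ sphereDist x y := by
  rw [dist_eq_two_mul_sin]
  linarith [Real.sin_le (show 0 ≤ sphereDist x y / 2 by linarith [sphereDist_nonneg x y])]

theorem sphereDist_le_two_mul_dist (x y : USphere n) : sphereDist x y ≤ 2 * dist x y := by
  have h1 := sphereDist_nonneg x y
  have h := Real.mul_le_sin (show 0 ≤ sphereDist x y / 2 by linarith)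
    (by linarith [sphereDist_le_pi x y])
  rw [dist_eq_two_mul_sin]
  -- Jordan's inequality gives the factor π/2; the bound π ≤ 4 rounds it to 2.
  have h4 : (1 : ℝ) / 2 ≤ 2 / Real.pi := by
    rw [div_le_div_iff₀ two_pos Real.pi_pos]
    linarith [Real.pi_le_four]
  nlinarith

theorem USphere.dist_le_two (x y : USphere n) : dist x y ≤ 2 := by
  rw [dist_eq_two_mul_sin]
  linarith [Real.sin_le_one (sphereDist x y / 2)]

/-- Cosine decreases on [0, π], so a cap is cut out of the sphere by an affine inequality. -/
theorem mem_cap_iff {c y : USphere n} {r : ℝ} (h0 : 0 ≤ r) (hr : r ≤ Real.pi) :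
    y ∈ cap c r ↔ Real.cos r < inner ℝ (c : ESpace n) y := by
  rw [← cos_sphereDist]
  exact (Real.strictAntiOn_cos.lt_iff_gt ⟨h0, hr⟩
    ⟨sphereDist_nonneg _ _, sphereDist_le_pi _ _⟩).symm

theorem USphere.exists_inner_eq_zero (hn : 1 ≤ n) (c : USphere n) :
    ∃ e : USphere n, inner ℝ (c : ESpace n) (e : ESpace n) = 0 := by
  have hfr : Module.finrank ℝ (ESpace n) = n + 1 := by simp
  have h1 : (Submodule.span ℝ {(c : ESpace n)})ᗮ ≠ ⊥ := by
    intro h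
    have h2 := Submodule.finrank_add_finrank_orthogonal (Submodule.span ℝ {(c : ESpace n)})
    rw [h, finrank_bot, hfr] at h2
    have h3 := finrank_span_le_card (R := ℝ) ({(c : ESpace n)} : Set (ESpace n))
    simp at h3
    omega
  obtain ⟨w, hw, hw0⟩ := Submodule.exists_mem_ne_zero_of_ne_bot h1
  have hw' : inner ℝ (c : ESpace n) w = 0 :=
    (Submodule.mem_orthogonal_singleton_iff_inner_right).1 hw
  refine ⟨⟨‖w‖⁻¹ • w, ?_⟩, ?_⟩
  · simp [norm_smul, hw0]
  · simp [inner_smul_right, hw']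

/-- A spherical cap of radius `r` contains points whose chordal distance to the centre is nearly
`2 sin (r / 2)`. -/
theorem le_pi_mul_of_cap_subset_closedBall (hn : 1 ≤ n) {c p : USphere n} {r δ : ℝ} (h0 : 0 < r)
    (hr : r < Real.pi) (h : cap c r ⊆ closedBall p δ) : r ≤ Real.pi * δ := by
  obtain ⟨e, he⟩ := USphere.exists_inner_eq_zero hn c
  -- The point at angle s from c on a great circle is in the open cap for every s < r. It and c both
  -- lie in the ball, so their chord is at most 2δ, and Jordan's inequality turns this into a bound
  -- for s.
  have key : ∀ s, 0 < s → s < r → s ≤ Real.pi * δ := by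
    intro s hs hsr
    have hyn : ‖Real.cos s • (c : ESpace n) + Real.sin s • (e : ESpace n)‖ = 1 := by
      refine (pow_left_inj₀ (norm_nonneg _) zero_le_one two_ne_zero).1 ?_
      rw [norm_add_sq_real, norm_smul, norm_smul, inner_smul_left, inner_smul_right, he]
      simp [Real.cos_sq_add_sin_sq]
    set y : USphere n := ⟨Real.cos s • (c : ESpace n) + Real.sin s • (e : ESpace n), by simp [hyn]⟩
      with hy
    have hcy : sphereDist c y = s := by
      have h1 : Real.cos (sphereDist c y) = Real.cos s := by
        rw [cos_sphereDist, hy]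
        simp [inner_add_right, inner_smul_right, he]
      exact Real.injOn_cos ⟨sphereDist_nonneg _ _, sphereDist_le_pi _ _⟩ ⟨hs.le, by linarith⟩ h1
    have hyc : y ∈ cap c r := by
      change sphereDist c y < r
      linarith
    have hcc : c ∈ cap c r := by
      rw [mem_cap_iff h0.le hr.le, real_inner_self_eq_norm_sq, USphere.norm_eq]
      have := Real.cos_lt_cos_of_nonneg_of_le_pi le_rfl hr.le h0
      simpa using this
    have h1 := mem_closedBall.1 (h hyc)
    have h2 := mem_closedBall'.1 (h hcc)
    have h3 : dist c y ≤ 2 * δ := by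
      rw [dist_comm y p] at h1
      rw [dist_comm p c] at h2
      linarith [dist_triangle c p y]
    rw [dist_eq_two_mul_sin, hcy] at h3
    have h4 := Real.mul_le_sin (show 0 ≤ s / 2 by linarith) (by linarith)
    have h5 : 2 / Real.pi * (s / 2) = s / Real.pi := by field_simp
    rw [h5, div_le_iff₀ Real.pi_pos] at h4
    nlinarith [Real.pi_pos]
  by_contra! hlt
  obtain ⟨s, hs1, hs2⟩ := exists_between (max_lt hlt h0)
  have := key s (lt_of_le_of_lt (le_max_right _ _) hs1) hs2
  linarith [le_max_left (Real.pi * δ) 0]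

end Sphere

/-! ### Möbius transformations -/

section Moebius

variable {n : ℕ}

theorem IsBallReflection.apply_apply {R : ESpace n → ESpace n} (hR : IsBallReflection R)
    (y : ESpace n) : R (R y) = y := by
  rcases hR with ⟨v, -, h⟩ | ⟨a, ha, h⟩
  · simp [h]
  · rw [h, h]
    apply EuclideanGeometry.inversion_inversion
    have : 0 < ‖a‖ ^ 2 - 1 := by nlinarith
    positivity

/-- A property that holds for the reflections and is closed under products holds for all Möbius
transformations of the ball. -/
theorem moebiusPairs_induction {Q : (USphere n ≃ₜ USphere n) × Equiv.Perm (UBall n) → Prop}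
    (one : Q 1) (mul : ∀ p q, Q p → Q q → Q (p * q))
    (refl : ∀ p (R : ESpace n → ESpace n), IsBallReflection R →
      (∀ x : USphere n, (p.1 x : ESpace n) = R x) →
      (∀ z : UBall n, (p.2 z : ESpace n) = R z) → Q p)
    {p : (USphere n ≃ₜ USphere n) × Equiv.Perm (UBall n)} (hp : p ∈ moebiusPairs n) : Q p := by
  refine Subgroup.closure_induction'' (p := fun p _ => Q p) ?_ ?_ one (fun p q _ _ => mul p q) hp
  · rintro p ⟨R, hR, h1, h2⟩
    exact refl p R hR h1 h2
  · rintro p ⟨R, hR, h1, h2⟩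
    -- The generators are involutions, so their inverses are again generators.
    have hpp : p * p = 1 := by
      refine Prod.ext ?_ ?_
      · ext x : 1
        exact Subtype.ext ((h1 (p.1 x)).trans (by rw [h1, hR.apply_apply]; rfl))
      · ext x : 1
        exact Subtype.ext ((h2 (p.2 x)).trans (by rw [h2, hR.apply_apply]; rfl))
    rw [inv_eq_of_mul_eq_one_left hpp]
    exact refl p R hR h1 h2

theorem ne_of_norm_le_one {a x : ESpace n} (ha : 1 < ‖a‖) (hx : ‖x‖ ≤ 1) : x ≠ a := by
  rintro rfl
  linarith

/-- The conformal factor of a Möbius transformation, given by the distortion of chords. -/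
theorem exists_conformalFactor {γ : USphere n ≃ₜ USphere n} (hγ : γ ∈ moebiusGroup n) :
    ∃ j : USphere n → ℝ, Continuous j ∧ (∀ x, 0 < j x) ∧
      ∀ x y, dist (γ x) (γ y) ^ 2 = j x * j y * dist x y ^ 2 := by
  obtain ⟨p, hp, rfl⟩ := hγ
  change ∃ j : USphere n → ℝ, Continuous j ∧ (∀ x, 0 < j x) ∧
      ∀ x y, dist (p.1 x) (p.1 y) ^ 2 = j x * j y * dist x y ^ 2
  refine moebiusPairs_induction (Q := fun p => ∃ j : USphere n → ℝ, Continuous j ∧ (∀ x, 0 < j x) ∧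
      ∀ x y, dist (p.1 x) (p.1 y) ^ 2 = j x * j y * dist x y ^ 2) ?_ ?_ ?_ hp
  · exact ⟨fun _ => 1, continuous_const, fun _ => one_pos, fun x y => by simp⟩
  · rintro p q ⟨j, hjc, hj0, hj⟩ ⟨k, hkc, hk0, hk⟩
    refine ⟨fun x => j (q.1 x) * k x, (hjc.comp q.1.continuous).mul hkc,
      fun x => mul_pos (hj0 _) (hk0 _), fun x y => ?_⟩
    change dist (p.1 (q.1 x)) (p.1 (q.1 y)) ^ 2 = _
    rw [hj, hk]
    ring
  · rintro p R (⟨v, -, h⟩ | ⟨a, ha, h⟩) h1 -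
    · refine ⟨fun _ => 1, continuous_const, fun _ => one_pos, fun x y => ?_⟩
      rw [Subtype.dist_eq, Subtype.dist_eq, h1, h1, h, h, LinearIsometryEquiv.dist_map]
      ring
    · have hxa : ∀ x : USphere n, (x : ESpace n) ≠ a := fun x =>
        ne_of_norm_le_one ha (USphere.norm_eq x).le
      have hd : ∀ x : USphere n, 0 < dist (x : ESpace n) a := fun x => dist_pos.2 (hxa x)
      have hR : 0 < √(‖a‖ ^ 2 - 1) := Real.sqrt_pos.2 (by nlinarith)
      -- An inversion of radius R about a multiplies the chord xy by R²/(|x − a||y − a|); squared,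
      -- this splits into a factor R²/|x − a|² at each end.
      refine ⟨fun x => (√(‖a‖ ^ 2 - 1)) ^ 2 / dist (x : ESpace n) a ^ 2, ?_, fun x => ?_,
        fun x y => ?_⟩
      · exact continuous_const.div ((continuous_subtype_val.dist continuous_const).pow 2)
          fun x => (pow_pos (hd x) 2).ne'
      · have := hd x
        positivity
      · rw [Subtype.dist_eq, Subtype.dist_eq, h1, h1, h, h,
          EuclideanGeometry.dist_inversion_inversion (hxa x) (hxa y)]
        have := (hd x).ne'
        have := (hd y).ne'
        field_simp

/-- The ball component of a pair is a bare permutation; continuity is what lets it carry frontiers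
to frontiers. -/
theorem continuous_of_mem_moebiusPairs {p : (USphere n ≃ₜ USphere n) × Equiv.Perm (UBall n)}
    (hp : p ∈ moebiusPairs n) : Continuous p.2 := by
  refine moebiusPairs_induction (Q := fun p => Continuous p.2) continuous_id
    (fun p q h1 h2 => h1.comp h2) ?_ hp
  rintro p R (⟨v, -, h⟩ | ⟨a, ha, h⟩) - h1
  · rw [continuous_induced_rng]
    refine Continuous.congr ?_ fun z => (h1 z).symm
    simp only [h]
    exact (LinearIsometryEquiv.continuous _).comp continuous_subtype_val
  · rw [continuous_induced_rng]
    refine Continuous.congr ?_ fun z => (h1 z).symm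
    simp only [h]
    exact continuous_const.inversion continuous_const continuous_subtype_val fun z =>
      ne_of_norm_le_one ha (mem_ball_zero_iff.1 z.2).le

/-- In the hyperboloid model, the Lorentz product of the point over `x` and of the vector `(v, t)`,
up to a positive factor. -/
noncomputable def lorentzForm (v : ESpace n) (t : ℝ) (x : ESpace n) : ℝ :=
  2 * inner ℝ v x - t * (1 + ‖x‖ ^ 2)

/-- The inversion acts on (v, t) as the Lorentz reflection in the vector (a, 1), whose Lorentz
square is ‖a‖² − 1; here that reflection is multiplied by ‖a‖² − 1 to clear denominators. -/
theorem lorentzForm_inversion {a : ESpace n} (ha : 1 < ‖a‖) (v : ESpace n) (t : ℝ) {x : ESpace n}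
    (hx : x ≠ a) :
    ‖x - a‖ ^ 2 * lorentzForm v t (EuclideanGeometry.inversion a (√(‖a‖ ^ 2 - 1)) x) =
      lorentzForm ((‖a‖ ^ 2 - 1) • v + (2 * (t - inner ℝ v a)) • a)
        (t * (‖a‖ ^ 2 + 1) - 2 * inner ℝ v a) x := by
  have hs : ‖x - a‖ ^ 2 ≠ 0 := by
    have := norm_pos_iff.2 (sub_ne_zero.2 hx)
    positivity
  have hρ : √(‖a‖ ^ 2 - 1) ^ 2 = ‖a‖ ^ 2 - 1 := Real.sq_sqrt (by nlinarith)
  have hsx : ‖x - a‖ ^ 2 = ‖x‖ ^ 2 - 2 * inner ℝ x a + ‖a‖ ^ 2 := norm_sub_sq_real x a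
  rw [EuclideanGeometry.inversion_def]
  simp only [vsub_eq_sub, vadd_eq_add, dist_eq_norm]
  rw [div_pow, hρ]
  set s := ‖x - a‖ ^ 2 with hsd
  unfold lorentzForm
  rw [norm_add_sq_real, norm_smul, mul_pow, ← hsd, inner_smul_left, inner_add_right,
    inner_smul_right, inner_sub_right, inner_sub_left, inner_add_left, inner_smul_left,
    inner_smul_left, real_inner_self_eq_norm_sq, Real.norm_eq_abs, sq_abs]
  simp only [conj_trivial]
  rw [real_inner_comm x a]
  field_simp
  rw [hsx]
  ring

theorem abs_lt_norm_iff {v : ESpace n} {t : ℝ} : |t| < ‖v‖ ↔ t ^ 2 < ‖v‖ ^ 2 := by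
  rw [← sq_lt_sq₀ (abs_nonneg t) (norm_nonneg v), sq_abs]

/-- Reflections act linearly on Lorentz vectors and keep spacelike vectors spacelike. One vector
serves for the sphere and for the ball, so caps and half-spaces stay matched. -/
theorem exists_lorentz_image {p : (USphere n ≃ₜ USphere n) × Equiv.Perm (UBall n)}
    (hp : p ∈ moebiusPairs n) (v : ESpace n) (t : ℝ) (hvt : |t| < ‖v‖) :
    ∃ (v' : ESpace n) (t' : ℝ), |t'| < ‖v'‖ ∧
      (∀ y : USphere n, 0 < lorentzForm v t y ↔ 0 < lorentzForm v' t' (p.1 y)) ∧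
      ∀ z : UBall n, 0 < lorentzForm v t z ↔ 0 < lorentzForm v' t' (p.2 z) := by
  revert v t
  refine moebiusPairs_induction (Q := fun p => ∀ (v : ESpace n) (t : ℝ), |t| < ‖v‖ →
    ∃ (v' : ESpace n) (t' : ℝ), |t'| < ‖v'‖ ∧
      (∀ y : USphere n, 0 < lorentzForm v t y ↔ 0 < lorentzForm v' t' (p.1 y)) ∧
      ∀ z : UBall n, 0 < lorentzForm v t z ↔ 0 < lorentzForm v' t' (p.2 z)) ?_ ?_ ?_ hp
  · exact fun v t h => ⟨v, t, h, fun _ => Iff.rfl, fun _ => Iff.rfl⟩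
  · intro p q hp hq v t h
    obtain ⟨v', t', h', a1, a2⟩ := hq v t h
    obtain ⟨v'', t'', h'', b1, b2⟩ := hp v' t' h'
    exact ⟨v'', t'', h'', fun y => (a1 y).trans (b1 _), fun z => (a2 z).trans (b2 _)⟩
  · rintro p R hR h1 h2 v t hvt
    suffices H : ∃ (v' : ESpace n) (t' : ℝ), |t'| < ‖v'‖ ∧
        ∀ x : ESpace n, ‖x‖ ≤ 1 → (0 < lorentzForm v t (R x) ↔ 0 < lorentzForm v' t' x) by
      obtain ⟨v', t', h', H⟩ := H
      refine ⟨v', t', h', fun y => ?_, fun z => ?_⟩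
      · rw [← H _ (USphere.norm_eq (p.1 y)).le, h1, hR.apply_apply]
      · rw [← H _ (mem_ball_zero_iff.1 (p.2 z).2).le, h2, hR.apply_apply]
    rcases hR with ⟨w, -, h⟩ | ⟨a, ha, h⟩
    · refine ⟨(Submodule.span ℝ {w})ᗮ.reflection v, t, by simpa using hvt, fun x _ => ?_⟩
      have h3 : inner ℝ v ((Submodule.span ℝ {w})ᗮ.reflection x) =
          inner ℝ ((Submodule.span ℝ {w})ᗮ.reflection v) x := by
        conv_rhs => rw [← Submodule.reflection_reflection (Submodule.span ℝ {w})ᗮ x]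
        rw [LinearIsometryEquiv.inner_map_map]
      simp [lorentzForm, h, h3]
    · refine ⟨(‖a‖ ^ 2 - 1) • v + (2 * (t - inner ℝ v a)) • a,
        t * (‖a‖ ^ 2 + 1) - 2 * inner ℝ v a, ?_, fun x hx => ?_⟩
      swap
      · have hxa := ne_of_norm_le_one ha hx
        rw [← lorentzForm_inversion ha v t hxa, h]
        have : 0 < ‖x - a‖ ^ 2 := by
          have := norm_pos_iff.2 (sub_ne_zero.2 hxa)
          positivity
        exact (mul_pos_iff_of_pos_left this).symm
      · rw [abs_lt_norm_iff] at hvt ⊢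
        rw [norm_add_sq_real, norm_smul, norm_smul, inner_smul_left, inner_smul_right, mul_pow,
          mul_pow, Real.norm_eq_abs, Real.norm_eq_abs, sq_abs, sq_abs]
        simp only [conj_trivial]
        -- The scaled reflection multiplies the Lorentz square ‖v‖² − t² by (‖a‖² − 1)².
        have h5 : 0 < (‖a‖ ^ 2 - 1) ^ 2 * (‖v‖ ^ 2 - t ^ 2) := by
          have : 0 < ‖a‖ ^ 2 - 1 := by nlinarith
          have : 0 < ‖v‖ ^ 2 - t ^ 2 := by linarith
          positivity
        linear_combination h5

theorem lorentzForm_coe_sphere (v : ESpace n) (t : ℝ) (y : USphere n) :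
    lorentzForm v t y = 2 * (inner ℝ v (y : ESpace n) - t) := by
  rw [lorentzForm, USphere.norm_eq]
  ring

/-- After division by ‖v‖ the centre is v/‖v‖ and the cosine of the radius is t/‖v‖; being spacelike
puts this cosine strictly between −1 and 1. -/
theorem exists_cap_of_lorentzForm {v : ESpace n} {t : ℝ} (hvt : |t| < ‖v‖) :
    ∃ (c : USphere n) (r : ℝ), 0 < r ∧ r < Real.pi ∧
      (∀ y : USphere n, y ∈ cap c r ↔ 0 < lorentzForm v t y) ∧
      ∀ z : UBall n, (z : ESpace n) ∈ halfSpace c r ↔ 0 < lorentzForm v t z := by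
  have hv : 0 < ‖v‖ := (abs_nonneg t).trans_lt hvt
  have ht := abs_lt.1 hvt
  have h1 : -1 < t / ‖v‖ := by rw [lt_div_iff₀ hv]; linarith
  have h2 : t / ‖v‖ < 1 := by rw [div_lt_iff₀ hv]; linarith
  have hc : Real.cos (Real.arccos (t / ‖v‖)) = t / ‖v‖ := Real.cos_arccos h1.le h2.le
  have h0 : 0 < Real.arccos (t / ‖v‖) := Real.arccos_pos.2 h2
  have hpi : Real.arccos (t / ‖v‖) < Real.pi :=
    (Real.arccos_le_pi _).lt_of_ne fun h => by rw [h, Real.cos_pi] at hc; linarith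
  have key : ∀ x : ESpace n, 2 * inner ℝ (‖v‖⁻¹ • v) x - t / ‖v‖ * (1 + ‖x‖ ^ 2) =
      ‖v‖⁻¹ * lorentzForm v t x := by
    intro x
    rw [lorentzForm, inner_smul_left]
    simp only [conj_trivial]
    field_simp
  refine ⟨⟨‖v‖⁻¹ • v, by simp [norm_smul, hv.ne']⟩, Real.arccos (t / ‖v‖), h0, hpi,
    fun y => ?_, fun z => ?_⟩
  · rw [mem_cap_iff h0.le hpi.le, hc]
    have := key y
    rw [USphere.norm_eq] at this
    rw [← mul_pos_iff_of_pos_left (inv_pos.2 hv), ← this, sub_pos]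
    constructor <;> intro h <;> linarith
  · have hz : ‖(z : ESpace n)‖ < 1 := mem_ball_zero_iff.1 z.2
    simp only [halfSpace, mem_ofPred_eq, hz, true_and, hc]
    rw [← mul_pos_iff_of_pos_left (inv_pos.2 hv), ← key, sub_pos]

/-- Möbius transformations map caps to caps, and the half-spaces over caps to the half-spaces over
their images. -/
theorem exists_cap_image {γ : USphere n ≃ₜ USphere n} {τ : Equiv.Perm (UBall n)}
    (h : IsPoincareExtension γ τ) (c : USphere n) {r : ℝ} (h0 : 0 < r) (hr : r < Real.pi) :
    ∃ (c' : USphere n) (r' : ℝ), 0 < r' ∧ r' < Real.pi ∧ γ '' cap c r = cap c' r' ∧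
      ∀ z : UBall n, (z : ESpace n) ∈ halfSpace c r ↔ (τ z : ESpace n) ∈ halfSpace c' r' := by
  have hcos : |Real.cos r| < ‖(c : ESpace n)‖ := by
    rw [USphere.norm_eq, abs_lt, ← Real.cos_pi, ← Real.cos_zero]
    exact ⟨Real.cos_lt_cos_of_nonneg_of_le_pi h0.le le_rfl hr,
      Real.cos_lt_cos_of_nonneg_of_le_pi le_rfl hr.le h0⟩
  obtain ⟨v', t', hvt, h1, h2⟩ := exists_lorentz_image h (c : ESpace n) (Real.cos r) hcos
  obtain ⟨c', r', h0', hr', h3, h4⟩ := exists_cap_of_lorentzForm hvt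
  refine ⟨c', r', h0', hr', ?_, fun z => ?_⟩
  · ext y
    rw [h3]
    obtain ⟨x, rfl⟩ := γ.surjective y
    rw [γ.injective.mem_set_image, mem_cap_iff h0.le hr.le, ← h1, lorentzForm_coe_sphere]
    simp
  · have hz : ‖(z : ESpace n)‖ < 1 := mem_ball_zero_iff.1 z.2
    rw [h4, ← h2]
    simp [halfSpace, hz, lorentzForm]

end Moebius

/-! ### The conformal factor and the distance to the limit set -/

namespace KleinianGroup

variable {n : ℕ} (Γ : KleinianGroup n)

theorem isClosed_limitSet : IsClosed Γ.limitSet := (isOpen_regularSet _).isClosed_compl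

variable {Γ}

/-- The sphere of dimension 0 has only the two points ±1. -/
theorem IsNonelementary.one_le (h : Γ.IsNonelementary) : 1 ≤ n := by
  by_contra! hn
  obtain rfl : n = 0 := by omega
  have h1 : Γ.limitSet.encard ≤ ({1, -1} : Set ℝ).encard := by
    refine Set.encard_le_encard_of_injOn (f := fun x : USphere 0 => (x : ESpace 0) 0) ?_ ?_
    · intro x _
      have h2 := USphere.norm_eq x
      rw [EuclideanSpace.norm_eq] at h2
      simp only [Nat.reduceAdd, Finset.univ_unique, Fin.default_eq_zero, Fin.isValue,
        Real.norm_eq_abs, sq_abs, Finset.sum_singleton, Real.sqrt_sq_eq_abs] at h2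
      simpa [eq_comm] using (abs_eq zero_le_one).1 h2
    · intro x _ y _ hxy
      ext i
      obtain rfl : i = 0 := Fin.fin_one_eq_zero i
      exact hxy
  have h2 : ({1, -1} : Set ℝ).encard = 2 := Set.encard_pair (by norm_num)
  rw [h2] at h1
  exact absurd h (not_lt.2 h1)

theorem IsNonelementary.exists_ne (h : Γ.IsNonelementary) :
    ∃ a ∈ Γ.limitSet, ∃ b ∈ Γ.limitSet, a ≠ b := by
  have : (1 : ℕ∞) < Γ.limitSet.encard := lt_trans (by norm_num) h
  obtain ⟨a, b, ha, hb, hab⟩ := Set.one_lt_encard_iff.1 this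
  exact ⟨a, ha, b, hb, hab⟩

theorem IsNonelementary.nonempty (h : Γ.IsNonelementary) : Γ.limitSet.Nonempty :=
  let ⟨a, ha, _⟩ := h.exists_ne
  ⟨a, ha⟩

theorem limitSet_invariant (γ : Γ.group) {x : USphere n} (hx : x ∈ Γ.limitSet) :
    γ.1 x ∈ Γ.limitSet := by
  intro h
  apply hx
  have := regularSet_invariant (γ⁻¹).2 h
  have h2 : (γ⁻¹ : Γ.group).1 (γ.1 x) = x := γ.1.symm_apply_apply x
  rwa [h2] at this

theorem exists_mem_limitSet_apply_eq (γ : Γ.group) {x : USphere n} (hx : x ∈ Γ.limitSet) :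
    ∃ y ∈ Γ.limitSet, γ.1 y = x :=
  ⟨(γ⁻¹ : Γ.group).1 x, limitSet_invariant _ hx, γ.1.apply_symm_apply x⟩

variable (Γ)

/-- The chordal distance to the limit set. -/
noncomputable def gap (x : USphere n) : ℝ := infDist x Γ.limitSet

theorem gap_nonneg (x : USphere n) : 0 ≤ Γ.gap x := infDist_nonneg

variable {Γ}

theorem gap_le_dist (x : USphere n) {y : USphere n} (hy : y ∈ Γ.limitSet) : Γ.gap x ≤ dist x y :=
  infDist_le_dist_of_mem hy

theorem gap_le_gap_add_dist (x y : USphere n) : Γ.gap x ≤ Γ.gap y + dist x y :=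
  infDist_le_infDist_add_dist

theorem gap_pos_iff (h : Γ.IsNonelementary) {x : USphere n} :
    0 < Γ.gap x ↔ x ∈ regularSet Γ.group := by
  rw [gap, ← Γ.isClosed_limitSet.notMem_iff_infDist_pos h.nonempty, limitSet, mem_compl_iff,
    not_not]

theorem gap_pos (h : Γ.IsNonelementary) (x : Γ.Omega) : 0 < Γ.gap x := (gap_pos_iff h).2 x.2

theorem gap_le_two (h : Γ.IsNonelementary) (x : USphere n) : Γ.gap x ≤ 2 := by
  obtain ⟨a, ha⟩ := h.nonempty
  exact (gap_le_dist x ha).trans (USphere.dist_le_two x a)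

theorem gap_le_distLimit (h : Γ.IsNonelementary) (x : Γ.Omega) : Γ.gap x ≤ Γ.distLimit x := by
  have : Nonempty Γ.limitSet := h.nonempty.to_subtype
  exact le_ciInf fun y => (gap_le_dist _ y.2).trans (dist_le_sphereDist _ _)

theorem distLimit_le_two_mul_gap (h : Γ.IsNonelementary) (x : Γ.Omega) :
    Γ.distLimit x ≤ 2 * Γ.gap x := by
  obtain ⟨y, hy, hxy⟩ := Γ.isClosed_limitSet.isCompact.exists_infDist_eq_dist h.nonempty x.1
  have hb : BddBelow (range fun y : Γ.limitSet => sphereDist (x : USphere n) y) :=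
    ⟨0, by rintro _ ⟨y, rfl⟩; exact sphereDist_nonneg _ _⟩
  refine (ciInf_le hb ⟨y, hy⟩).trans ?_
  rw [gap, hxy]
  exact sphereDist_le_two_mul_dist _ _

theorem distLimit_pos (h : Γ.IsNonelementary) (x : Γ.Omega) : 0 < Γ.distLimit x :=
  (gap_pos h x).trans_le (gap_le_distLimit h x)

variable (Γ) in
/-- The conformal factor of an element of the group. -/
noncomputable def factor (γ : Γ.group) : USphere n → ℝ :=
  (exists_conformalFactor (Γ.le_moebius γ.2)).choose

theorem continuous_factor (γ : Γ.group) : Continuous (Γ.factor γ) :=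
  (exists_conformalFactor (Γ.le_moebius γ.2)).choose_spec.1

theorem factor_pos (γ : Γ.group) (x : USphere n) : 0 < Γ.factor γ x :=
  (exists_conformalFactor (Γ.le_moebius γ.2)).choose_spec.2.1 x

theorem dist_apply_sq (γ : Γ.group) (x y : USphere n) :
    dist (γ.1 x) (γ.1 y) ^ 2 = Γ.factor γ x * Γ.factor γ y * dist x y ^ 2 :=
  (exists_conformalFactor (Γ.le_moebius γ.2)).choose_spec.2.2 x y

/-- The conformal factor at a point is determined by the distortion of a triangle. -/
theorem factor_mul_dist (γ : Γ.group) (x y z : USphere n) :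
    Γ.factor γ x * (dist x y * dist x z * dist (γ.1 y) (γ.1 z)) =
      dist (γ.1 x) (γ.1 y) * dist (γ.1 x) (γ.1 z) * dist y z := by
  have h := factor_pos γ
  refine (pow_left_inj₀ (mul_nonneg (h x).le (by positivity)) (by positivity) two_ne_zero).1 ?_
  simp only [mul_pow, dist_apply_sq]
  ring

/-- The factor is obtained by choice, but the triangle formed by x and two distinct limit points
determines it. Since x lies in Ω, no side degenerates, and the cocycle law is read off from the
three identities. -/
theorem factor_mul (hne : Γ.IsNonelementary) (γ δ : Γ.group) (x : Γ.Omega) :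
    Γ.factor (γ * δ) x = Γ.factor γ (δ.1 x) * Γ.factor δ x := by
  obtain ⟨y, hy, z, hz, hyz⟩ := hne.exists_ne
  have hxy : x.1 ≠ y := fun h => hy (h ▸ x.2)
  have hxz : x.1 ≠ z := fun h => hz (h ▸ x.2)
  have e1 := factor_mul_dist (γ * δ) x y z
  have e2 := factor_mul_dist γ (δ.1 x) (δ.1 y) (δ.1 z)
  have e3 := factor_mul_dist δ x y z
  have p1 : ∀ w, (γ * δ).1 w = γ.1 (δ.1 w) := fun _ => rfl
  rw [p1, p1, p1] at e1
  have hpos : ∀ {u v : USphere n}, u ≠ v → dist u v ≠ 0 := fun h => (dist_pos.2 h).ne'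
  have q1 := hpos hxy
  have q2 := hpos hxz
  have q3 := hpos hyz
  have q4 := hpos (δ.1.injective.ne hxy)
  have q5 := hpos (δ.1.injective.ne hxz)
  have q6 := hpos (δ.1.injective.ne hyz)
  have q7 := hpos (γ.1.injective.ne (δ.1.injective.ne hyz))
  have e1' := (eq_div_iff (by positivity)).2 e1
  have e2' := (eq_div_iff (by positivity)).2 e2
  have e3' := (eq_div_iff (by positivity)).2 e3
  rw [e1', e2', e3']
  field_simp

theorem factor_one (hne : Γ.IsNonelementary) (x : Γ.Omega) : Γ.factor 1 x = 1 := by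
  have h := factor_mul hne 1 1 x
  rw [one_mul] at h
  have h1 : (1 : Γ.group).1 x.1 = x.1 := rfl
  rw [h1] at h
  have := factor_pos (1 : Γ.group) x.1
  exact (mul_left_cancel₀ this.ne' (by linarith)).symm

theorem factor_inv_mul (hne : Γ.IsNonelementary) (γ : Γ.group) (x : Γ.Omega) :
    Γ.factor γ⁻¹ (γ.1 x) * Γ.factor γ x = 1 := by
  rw [← factor_mul hne, inv_mul_cancel, factor_one hne]

/-- A Möbius transformation in the group cannot expand a large ball in the domain of
discontinuity. -/
theorem exists_factor_mul_gap_le (hne : Γ.IsNonelementary) :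
    ∃ C > 0, ∀ (γ : Γ.group) (x : Γ.Omega), Γ.factor γ x * Γ.gap x ≤ C := by
  obtain ⟨a, ha, b, hb, hab⟩ := hne.exists_ne
  have hd := dist_pos.2 hab
  refine ⟨8 / dist a b, by positivity, fun γ x => ?_⟩
  obtain ⟨y, hy, rfl⟩ := exists_mem_limitSet_apply_eq γ ha
  obtain ⟨z, hz, rfl⟩ := exists_mem_limitSet_apply_eq γ hb
  have e := factor_mul_dist γ x y z
  have hg := gap_pos hne x
  have hP := gap_le_dist x.1 hy
  have hQ := gap_le_dist x.1 hz
  have hj := factor_pos γ x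
  have h1 := USphere.dist_le_two (γ.1 x) (γ.1 y)
  have h2 := USphere.dist_le_two (γ.1 x) (γ.1 z)
  have h3 := dist_triangle_left y z x.1
  rw [le_div_iff₀ hd]
  set P := dist x.1 y
  set Q := dist x.1 z
  -- The triangle identity gives j·P·Q·|γy − γz| ≤ 4(P + Q), while gap ≤ P, Q gives (P + Q)·gap ≤
  -- 2PQ. Together they bound j·gap·|γy − γz| by 8.
  have h4 : dist (γ.1 x) (γ.1 y) * dist (γ.1 x) (γ.1 z) * dist y z ≤ 2 * 2 * (P + Q) := by
    gcongr
  have h5 : (P + Q) * Γ.gap x ≤ 2 * (P * Q) := by nlinarith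
  have h6 : 0 < Γ.factor γ x * dist (γ.1 y) (γ.1 z) := by positivity
  have h7 := mul_le_mul_of_nonneg_left h5 h6.le
  have hPQ : 0 < P + Q := by linarith
  refine le_of_mul_le_mul_right ?_ hPQ
  nlinarith

/-- A cocompact action has a compact set that meets all orbits. -/
theorem exists_compact_fundamental (hcpt : CompactSpace Γ.Manifold) :
    ∃ D : Set Γ.Omega, IsCompact D ∧ ∀ x, ∃ γ : Γ.group, ∃ d ∈ D, γ • d = x := by
  have : LocallyCompactSpace Γ.Omega := (Γ.Omega.isOpen).locallyCompactSpace
  have hcov := Γ.isQuotientCoveringMap_proj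
  choose K hK hxK using fun x : Γ.Omega => exists_compact_mem_nhds x
  obtain ⟨t, ht⟩ := isCompact_univ.elim_finite_subcover (fun x : Γ.Omega => Γ.proj '' interior (K x))
    (fun x => Γ.isLocalHomeomorph_proj.isOpenMap _ isOpen_interior) (fun q _ => by
      obtain ⟨x, rfl⟩ := hcov.surjective q
      exact mem_iUnion.2 ⟨x, x, mem_interior_iff_mem_nhds.2 (hxK x), rfl⟩)
  refine ⟨⋃ x ∈ t, K x, t.isCompact_biUnion fun x _ => hK x, fun x => ?_⟩
  obtain ⟨y, hy, d, hd, hdx⟩ := mem_iUnion₂.1 (ht (mem_univ (Γ.proj x)))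
  obtain ⟨γ, hγ⟩ := hcov.apply_eq_iff_mem_orbit.1 hdx.symm
  exact ⟨γ, d, mem_iUnion₂.2 ⟨y, hy, interior_subset hd⟩, hγ⟩

theorem continuous_gap : Continuous Γ.gap := continuous_infDist_pt _

theorem exists_pos_le_gap (hne : Γ.IsNonelementary) {D : Set Γ.Omega} (hD : IsCompact D) :
    ∃ c > 0, ∀ d ∈ D, c ≤ Γ.gap d := by
  rcases D.eq_empty_or_nonempty with rfl | hD0
  · exact ⟨1, one_pos, by simp⟩
  obtain ⟨d, -, hd⟩ := hD.exists_isMinOn hD0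
    (continuous_gap.comp continuous_subtype_val).continuousOn
  exact ⟨Γ.gap d, gap_pos hne d, fun x hx => hd hx⟩

/-- Over a compact set, the conformal factor is comparable with the distance to the limit set. -/
theorem exists_factor_comparable_of_isCompact (hne : Γ.IsNonelementary) {D : Set Γ.Omega}
    (hD : IsCompact D) :
    ∃ C > 0, ∀ (γ : Γ.group), ∀ d ∈ D, Γ.factor γ d ≤ C * Γ.gap (γ.1 d) ∧
      Γ.gap (γ.1 d) ≤ C * Γ.factor γ d := by
  obtain ⟨C, hC, hCx⟩ := exists_factor_mul_gap_le hne
  obtain ⟨c, hc, hcD⟩ := exists_pos_le_gap hne hD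
  obtain ⟨a, ha, b, hb, hab⟩ := hne.exists_ne
  have hd := dist_pos.2 hab
  have h1 : ∀ (γ : Γ.group), ∀ d ∈ D,
      Γ.factor γ d ≤ 8 / (c ^ 2 * dist a b) * Γ.gap (γ.1 d) := by
    intro γ d hdD
    -- The triangle d, y, z is chosen so that γy is a limit point nearest to γd, which makes gap(γd)
    -- a side, and γz is a limit point at distance at least |a − b|/2 from it. The sides at d are at
    -- least c.
    obtain ⟨y', hy', hy'd⟩ :=
      Γ.isClosed_limitSet.isCompact.exists_infDist_eq_dist hne.nonempty (γ.1 d)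
    obtain ⟨z', hz', hz'y⟩ : ∃ z' ∈ Γ.limitSet, dist a b / 2 ≤ dist y' z' := by
      by_contra! hcon
      linarith [hcon a ha, hcon b hb, dist_triangle_left a b y']
    change Γ.gap (γ.1 d) = _ at hy'd
    obtain ⟨y, hy, rfl⟩ := exists_mem_limitSet_apply_eq γ hy'
    obtain ⟨z, hz, rfl⟩ := exists_mem_limitSet_apply_eq γ hz'
    have e := factor_mul_dist γ d y z
    rw [← hy'd] at e
    have hP := (hcD d hdD).trans (gap_le_dist d.1 hy)
    have hQ := (hcD d hdD).trans (gap_le_dist d.1 hz)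
    have hj := factor_pos γ d
    have h4 : Γ.factor γ d * (c * c * (dist a b / 2)) ≤
        Γ.factor γ d * (dist d.1 y * dist d.1 z * dist (γ.1 y) (γ.1 z)) := by
      gcongr
    have h5 : Γ.gap (γ.1 d) * dist (γ.1 d) (γ.1 z) * dist y z ≤ Γ.gap (γ.1 d) * 2 * 2 := by
      have := Γ.gap_nonneg (γ.1 d)
      gcongr <;> exact USphere.dist_le_two _ _
    rw [div_mul_eq_mul_div, le_div_iff₀ (by positivity)]
    linarith
  refine ⟨8 / (c ^ 2 * dist a b) + C, by positivity, fun γ d hdD => ⟨?_, ?_⟩⟩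
  · refine (h1 γ d hdD).trans (mul_le_mul_of_nonneg_right (by linarith) (Γ.gap_nonneg _))
  · have h2 := hCx γ⁻¹ (γ • d)
    rw [coe_smul] at h2
    have h3 := factor_inv_mul hne γ d
    have h4 := factor_pos γ d
    have h5 : Γ.gap (γ.1 d) ≤ C * Γ.factor γ d := by
      calc Γ.gap (γ.1 d) = (Γ.factor γ⁻¹ (γ.1 d) * Γ.factor γ d) * Γ.gap (γ.1 d) := by
            rw [h3, one_mul]
        _ = (Γ.factor γ⁻¹ (γ.1 d) * Γ.gap (γ.1 d)) * Γ.factor γ d := by ring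
        _ ≤ C * Γ.factor γ d := by gcongr
    refine h5.trans (mul_le_mul_of_nonneg_right ?_ h4.le)
    have : 0 < 8 / (c ^ 2 * dist a b) := by positivity
    linarith

/-- The distance to the limit set is a conformal density, up to bounded factors. -/
theorem exists_factor_mul_gap_le_gap (hne : Γ.IsNonelementary) (hcpt : CompactSpace Γ.Manifold) :
    ∃ K : ℝ, 1 ≤ K ∧ ∀ (γ : Γ.group) (x : Γ.Omega),
      Γ.factor γ x * Γ.gap x ≤ K * Γ.gap (γ.1 x) := by
  obtain ⟨D, hD, hDx⟩ := exists_compact_fundamental hcpt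
  obtain ⟨C, hC, h⟩ := exists_factor_comparable_of_isCompact hne hD
  refine ⟨max 1 (C * C), le_max_left _ _, fun γ x => ?_⟩
  -- With x = δd, the factor of γ at x is the quotient of the factors of γδ and of δ at d, each
  -- comparable with a gap.
  obtain ⟨δ, d, hd, rfl⟩ := hDx x
  rw [coe_smul]
  have h1 := (h (γ * δ) d hd).1
  have h2 := (h δ d hd).2
  rw [factor_mul hne] at h1
  have h3 := factor_pos γ (δ.1 d)
  have h5 : 0 ≤ Γ.gap (γ.1 (δ.1 d)) := Γ.gap_nonneg _
  calc Γ.factor γ (δ.1 d) * Γ.gap (δ.1 d) ≤ Γ.factor γ (δ.1 d) * (C * Γ.factor δ d) := by gcongr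
    _ = C * (Γ.factor γ (δ.1 d) * Γ.factor δ d) := by ring
    _ ≤ C * (C * Γ.gap (γ.1 (δ.1 d))) := by exact mul_le_mul_of_nonneg_left h1 hC.le
    _ = C * C * Γ.gap (γ.1 (δ.1 d)) := by ring
    _ ≤ max 1 (C * C) * Γ.gap (γ.1 (δ.1 d)) := by gcongr; exact le_max_right _ _

/-- The radius of a ball of the family is small compared with the distance of its points to the
limit set. -/
theorem exists_ballFamily_radius_le (hne : Γ.IsNonelementary) (hcpt : CompactSpace Γ.Manifold) :
    ∃ C : ℝ, 1 ≤ C ∧ ∀ ε, 0 < ε → C * ε ≤ 1 → ∀ p ∈ Γ.ballFamily ε, ∀ x ∈ cap p.1 p.2,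
      x ∈ regularSet Γ.group ∧ p.2 ≤ C * ε * Γ.gap x := by
  obtain ⟨K, hK, h⟩ := exists_factor_mul_gap_le_gap hne hcpt
  refine ⟨48 * K, by linarith, ?_⟩
  rintro ε hε hKε ⟨c, r⟩ ⟨hr0, hrpi, x₀, γ, hγ, hcap⟩ x hx
  dsimp only at hr0 hrpi hcap hx ⊢
  lift γ to Γ.group using hγ
  set g₀ := Γ.gap x₀ with hg₀
  set G₀ := Γ.gap (γ.1 x₀) with hG₀
  have hg₀p : 0 < g₀ := gap_pos hne x₀
  have hG₀p : 0 < G₀ := gap_pos hne (γ • x₀)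
  have hε1 : ε ≤ 1 / 48 := by nlinarith
  -- The estimate below produces 8K²ε², which A² = 9K²ε² dominates; Cε ≤ 1 with C = 48K makes A ≤
  -- 1/16.
  set A := 3 * K * ε with hA
  have hAp : 0 < A := by positivity
  have hA1 : A ≤ 1 / 16 := by rw [hA]; linarith
  have key : ∀ y ∈ cap x₀.1 (ε * Γ.distLimit x₀),
      y ∈ regularSet Γ.group ∧ dist (γ.1 y) (γ.1 x₀) ≤ 2 * A * G₀ := by
    intro y hy
    have hyd : dist y x₀.1 ≤ 2 * ε * g₀ := by
      rw [dist_comm]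
      refine (dist_le_sphereDist _ _).trans (le_of_lt (lt_of_lt_of_le hy ?_))
      nlinarith [distLimit_le_two_mul_gap hne x₀]
    have hgy : g₀ / 2 ≤ Γ.gap y := by
      have := gap_le_gap_add_dist (Γ := Γ) x₀.1 y
      rw [dist_comm] at this
      nlinarith
    have hyΩ : y ∈ regularSet Γ.group := (gap_pos_iff hne).1 (by linarith)
    refine ⟨hyΩ, ?_⟩
    have e := dist_apply_sq γ y x₀
    have b1 := h γ ⟨y, hyΩ⟩
    have b2 := h γ x₀
    have j1 := factor_pos γ y
    have j2 := factor_pos γ x₀.1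
    have b1' : Γ.factor γ y * g₀ ≤ 2 * K * Γ.gap (γ.1 y) := by
      dsimp only at b1
      nlinarith
    have hgγ := gap_le_gap_add_dist (Γ := Γ) (γ.1 y) (γ.1 x₀)
    set m := dist (γ.1 y) (γ.1 x₀) with hm
    have hm0 : 0 ≤ m := dist_nonneg
    have hm2 : m ^ 2 ≤ A ^ 2 * (G₀ * (G₀ + m)) := by
      calc m ^ 2 ≤ Γ.factor γ y * Γ.factor γ x₀ * (2 * ε * g₀) ^ 2 := by rw [e]; gcongr
        _ = 4 * ε ^ 2 * ((Γ.factor γ y * g₀) * (Γ.factor γ x₀ * g₀)) := by ring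
        _ ≤ 4 * ε ^ 2 * ((2 * K * (G₀ + m)) * (K * G₀)) := by
            have : 0 ≤ Γ.factor γ x₀ * g₀ := by positivity
            have h9 : Γ.factor γ y * g₀ ≤ 2 * K * (G₀ + m) := b1'.trans (by gcongr)
            gcongr
        _ ≤ A ^ 2 * (G₀ * (G₀ + m)) := by
            have : 0 ≤ ε ^ 2 * (K ^ 2 * (G₀ * (G₀ + m))) := by positivity
            rw [hA]
            nlinarith
    -- The unknown m occurs on both sides of `hm2`. If m > 2AG₀, the left side is at least 2AG₀m and
    -- the right side at most (1/2 + 1/16)AG₀m.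
    by_contra! hlt
    have h10 : 0 < A * G₀ := by positivity
    have h14 : 2 * (A * G₀) * m ≤ m ^ 2 := by nlinarith
    have h15 : A * G₀ * (A * G₀) ≤ A * G₀ * m / 2 := by nlinarith
    have h16 : A * (A * G₀ * m) ≤ 1 / 16 * (A * G₀ * m) := by gcongr
    have h17 : 0 < A * G₀ * m := mul_pos h10 (by linarith)
    linarith [show A ^ 2 * (G₀ * (G₀ + m)) = A * G₀ * (A * G₀) + A * (A * G₀ * m) by ring]
  have hsub : cap c r ⊆ closedBall (γ.1 x₀) (2 * A * G₀) := by
    rw [← hcap]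
    rintro _ ⟨y, hy, rfl⟩
    exact (key y hy).2
  have hr := le_pi_mul_of_cap_subset_closedBall hne.one_le hr0 hrpi hsub
  have hx' := hx
  rw [← hcap] at hx'
  obtain ⟨y, hy, rfl⟩ := hx'
  obtain ⟨hy1, hy2⟩ := key y hy
  refine ⟨regularSet_invariant γ.2 hy1, ?_⟩
  have h11 := gap_le_gap_add_dist (Γ := Γ) (γ.1 x₀) (γ.1 y)
  rw [dist_comm] at h11
  have h12 : G₀ / 2 ≤ Γ.gap (γ.1 y) := by nlinarith
  have h13 : 0 < A * G₀ := by positivity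
  calc r ≤ Real.pi * (2 * A * G₀) := hr
    _ ≤ 4 * (2 * A * G₀) := by gcongr; exact Real.pi_le_four
    _ = 16 * A * (G₀ / 2) := by ring
    _ ≤ 16 * A * Γ.gap (γ.1 y) := by gcongr
    _ = 48 * K * ε * Γ.gap (γ.1 y) := by rw [hA]; ring

end KleinianGroup

/-! ### Unions of half-spaces over small caps -/

section SupportFunction

variable {n : ℕ} {S : Set (USphere n × ℝ)}

/-- The union of the half-spaces over the caps of the family `S` is described by this sublinear
function, see `mem_iUnion_halfSpace_iff`. -/
noncomputable def supportFun (S : Set (USphere n × ℝ)) (z : ESpace n) : ℝ :=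
  ⨆ p : S, inner ℝ (p.1.1 : ESpace n) z / Real.cos p.1.2

theorem inner_div_cos_sub_le {c : USphere n} {r : ℝ} (hr : 1 / 2 ≤ Real.cos r) (z w : ESpace n) :
    inner ℝ (c : ESpace n) z / Real.cos r - inner ℝ (c : ESpace n) w / Real.cos r ≤
      2 * ‖z - w‖ := by
  rw [← sub_div, ← inner_sub_right, div_le_iff₀ (by linarith)]
  have h := real_inner_le_norm (c : ESpace n) (z - w)
  rw [USphere.norm_eq, one_mul] at h
  nlinarith [norm_nonneg (z - w)]

variable (hS : ∀ p ∈ S, 1 / 2 ≤ Real.cos p.2)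

include hS

theorem bddAbove_supportFun (z : ESpace n) :
    BddAbove (range fun p : S => inner ℝ (p.1.1 : ESpace n) z / Real.cos p.1.2) := by
  refine ⟨2 * ‖z‖, ?_⟩
  rintro _ ⟨p, rfl⟩
  simpa using inner_div_cos_sub_le (c := p.1.1) (hS p.1 p.2) z 0

theorem le_supportFun {p : USphere n × ℝ} (hp : p ∈ S) (z : ESpace n) :
    inner ℝ (p.1 : ESpace n) z / Real.cos p.2 ≤ supportFun S z :=
  le_ciSup (bddAbove_supportFun hS z) ⟨p, hp⟩

theorem lt_supportFun_iff (hne : S.Nonempty) {a : ℝ} {z : ESpace n} :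
    a < supportFun S z ↔ ∃ p ∈ S, a < inner ℝ (p.1 : ESpace n) z / Real.cos p.2 := by
  have := hne.to_subtype
  rw [supportFun, lt_ciSup_iff (bddAbove_supportFun hS z)]
  simp only [Subtype.exists, exists_prop]

theorem supportFun_sub_le (hne : S.Nonempty) (z w : ESpace n) :
    supportFun S z - supportFun S w ≤ 2 * ‖z - w‖ := by
  have := hne.to_subtype
  rw [sub_le_iff_le_add]
  refine ciSup_le fun p => ?_
  linarith [le_supportFun hS p.2 w, inner_div_cos_sub_le (c := p.1.1) (hS p.1 p.2) z w]

theorem continuous_supportFun (hne : S.Nonempty) : Continuous (supportFun S) := by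
  refine (LipschitzWith.of_dist_le_mul (K := 2) fun z w => ?_).continuous
  rw [Real.dist_eq, dist_eq_norm, abs_sub_le_iff]
  refine ⟨supportFun_sub_le hS hne z w, ?_⟩
  rw [norm_sub_rev]
  exact supportFun_sub_le hS hne w z

omit hS in
theorem supportFun_smul {t : ℝ} (ht : 0 ≤ t) (z : ESpace n) :
    supportFun S (t • z) = t * supportFun S z := by
  rw [supportFun, supportFun, Real.mul_iSup_of_nonneg ht]
  congr 1
  ext p
  rw [inner_smul_right, mul_div_assoc]

theorem mem_iUnion_halfSpace_iff (hne : S.Nonempty) {z : ESpace n} :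
    z ∈ ⋃ p ∈ S, halfSpace p.1 p.2 ↔ ‖z‖ < 1 ∧ 1 + ‖z‖ ^ 2 < 2 * supportFun S z := by
  have h : 1 + ‖z‖ ^ 2 < 2 * supportFun S z ↔ (1 + ‖z‖ ^ 2) / 2 < supportFun S z := by
    rw [div_lt_iff₀' two_pos]
  rw [h, lt_supportFun_iff hS hne, mem_iUnion₂]
  constructor
  · rintro ⟨p, hp, hz1, hz2⟩
    refine ⟨hz1, p, hp, ?_⟩
    rw [lt_div_iff₀ (by linarith [hS p hp])]
    linarith
  · rintro ⟨hz1, p, hp, hz2⟩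
    refine ⟨p, hp, hz1, ?_⟩
    rw [lt_div_iff₀ (by linarith [hS p hp])] at hz2
    linarith

/-- A point with equality is a limit of points of the union: moving outwards along its ray
multiplies the support function by 1 + η, while 1 + ‖z‖² grows by a smaller factor because ‖z‖ < 1.
-/
theorem frontier_iUnion_halfSpace_inter_ball (hne : S.Nonempty) :
    frontier (⋃ p ∈ S, halfSpace p.1 p.2) ∩ ball 0 1 =
      {z : ESpace n | ‖z‖ < 1 ∧ 1 + ‖z‖ ^ 2 = 2 * supportFun S z} := by
  have hU : (⋃ p ∈ S, halfSpace p.1 p.2) =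
      {z : ESpace n | ‖z‖ < 1 ∧ 1 + ‖z‖ ^ 2 < 2 * supportFun S z} :=
    Set.ext fun z => mem_iUnion_halfSpace_iff hS hne
  have hc1 : Continuous fun z : ESpace n => 1 + ‖z‖ ^ 2 := by fun_prop
  have hc2 : Continuous fun z : ESpace n => 2 * supportFun S z :=
    continuous_const.mul (continuous_supportFun hS hne)
  have hopen : IsOpen {z : ESpace n | ‖z‖ < 1 ∧ 1 + ‖z‖ ^ 2 < 2 * supportFun S z} :=
    (isOpen_lt continuous_norm continuous_const).inter (isOpen_lt hc1 hc2)
  rw [hU, hopen.frontier_eq]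
  ext z
  constructor
  · rintro ⟨⟨h1, h2⟩, h3⟩
    have hz := mem_ball_zero_iff.1 h3
    refine ⟨hz, le_antisymm ?_ ?_⟩
    · exact closure_minimal (fun w hw => hw.2.le) (isClosed_le hc1 hc2) h1
    · by_contra! hlt
      exact h2 ⟨hz, hlt⟩
  · rintro ⟨h1, h2⟩
    refine ⟨⟨?_, fun h => h.2.ne h2⟩, mem_ball_zero_iff.2 h1⟩
    have ht : Tendsto (fun η : ℝ => (1 + η) • z) (𝓝[>] 0) (𝓝 z) := by
      have : Continuous fun η : ℝ => (1 + η) • z := by fun_prop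
      have h := (this.tendsto 0).mono_left (nhdsWithin_le_nhds (s := Ioi 0))
      simpa using h
    refine mem_closure_of_tendsto ht ?_
    have hlt : ∀ᶠ η in 𝓝[>] (0 : ℝ), ‖(1 + η) • z‖ < 1 :=
      (continuous_norm.tendsto z).comp ht |>.eventually_lt_const h1
    filter_upwards [hlt, self_mem_nhdsWithin] with η hη hη0
    have hη0' : 0 < η := hη0
    refine ⟨hη, ?_⟩
    rw [supportFun_smul (by linarith)]
    rw [norm_smul, Real.norm_eq_abs, abs_of_pos (by linarith : 0 < 1 + η)] at hη ⊢
    have h5 : ((1 + η) * ‖z‖) ^ 2 < 1 := by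
      have : 0 ≤ (1 + η) * ‖z‖ := by positivity
      nlinarith
    have h6 : (1 + η) * ‖z‖ ^ 2 < 1 := by nlinarith [sq_nonneg ‖z‖]
    nlinarith

end SupportFunction

namespace KleinianGroup

variable {n : ℕ} {Γ : KleinianGroup n}

/-! ### Invariance of the graph -/

/-- The family contains all Γ-images of its caps, and a Möbius map carries the half-space over a cap
to the half-space over the image. -/
theorem apply_mem_iUnion_halfSpace (γ : Γ.group) {τ : Equiv.Perm (UBall n)}
    (h : IsPoincareExtension γ.1 τ) {ε : ℝ} {z : UBall n}
    (hz : (z : ESpace n) ∈ ⋃ p ∈ Γ.ballFamily ε, halfSpace p.1 p.2) :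
    (τ z : ESpace n) ∈ ⋃ p ∈ Γ.ballFamily ε, halfSpace p.1 p.2 := by
  obtain ⟨⟨c, r⟩, ⟨h0, hpi, x, δ, hδ, hcap⟩, hz⟩ := mem_iUnion₂.1 hz
  obtain ⟨c', r', h0', hpi', hcap', hH⟩ := exists_cap_image h c h0 hpi
  refine mem_iUnion₂.2 ⟨(c', r'), ⟨h0', hpi', x, γ.1 * δ, Γ.group.mul_mem γ.2 hδ, ?_⟩,
    (hH z).1 hz⟩
  rw [← hcap', ← hcap, image_image]
  rfl

theorem image_graph (γ : Γ.group) {τ : Equiv.Perm (UBall n)} (h : IsPoincareExtension γ.1 τ)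
    (ε : ℝ) :
    (fun z => (τ z : ESpace n)) '' {z | (z : ESpace n) ∈ Γ.graph ε} = Γ.graph ε := by
  have hinv : IsPoincareExtension (γ⁻¹ : Γ.group).1 τ⁻¹ := (moebiusPairs n).inv_mem h
  set T : UBall n ≃ₜ UBall n :=
    { toEquiv := τ
      continuous_toFun := continuous_of_mem_moebiusPairs h
      continuous_invFun := continuous_of_mem_moebiusPairs hinv } with hT
  set U : Set (ESpace n) := ⋃ p ∈ Γ.ballFamily ε, halfSpace p.1 p.2 with hU
  have himg : T '' (Subtype.val ⁻¹' U) = Subtype.val ⁻¹' U := by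
    refine Subset.antisymm ?_ fun z hz => ?_
    · rintro _ ⟨z, hz, rfl⟩
      exact apply_mem_iUnion_halfSpace γ h hz
    · exact ⟨τ⁻¹ z, apply_mem_iUnion_halfSpace γ⁻¹ hinv hz, τ.apply_symm_apply z⟩
  -- Since the ball is open, the Euclidean frontier restricts to the relative frontier, which the
  -- homeomorphism `T` preserves.
  have hfr : (Subtype.val ⁻¹' frontier U : Set (UBall n)) = frontier (Subtype.val ⁻¹' U) :=
    (isOpen_ball.isOpenMap_subtype_val).preimage_frontier_eq_frontier_preimage
      continuous_subtype_val U
  have hg : {z : UBall n | (z : ESpace n) ∈ Γ.graph ε} = Subtype.val ⁻¹' frontier U := by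
    ext z
    exact and_iff_left z.2
  have h1 : T '' {z : UBall n | (z : ESpace n) ∈ Γ.graph ε} =
      {z : UBall n | (z : ESpace n) ∈ Γ.graph ε} := by
    rw [hg, hfr, T.image_frontier, himg]
  have h2 : (fun z => (τ z : ESpace n)) '' {z | (z : ESpace n) ∈ Γ.graph ε} =
      Subtype.val '' (T '' {z : UBall n | (z : ESpace n) ∈ Γ.graph ε}) := by
    rw [image_image]
    rfl
  rw [h2, h1]
  ext z
  constructor
  · rintro ⟨w, hw, rfl⟩
    exact hw
  · exact fun hz => ⟨⟨z, hz.2⟩, hz, rfl⟩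

/-! ### The radial function of the graph -/

/-- The value on `Ω(Γ)` of the support function of the family of balls. -/
noncomputable def level (Γ : KleinianGroup n) (ε : ℝ) (x : Γ.Omega) : ℝ :=
  supportFun (Γ.ballFamily ε) (Γ.incl x)

/-- The radial function of the graph. -/
noncomputable def radius (Γ : KleinianGroup n) (ε : ℝ) (x : Γ.Omega) : ℝ :=
  Γ.level ε x - √(Γ.level ε x ^ 2 - 1)

theorem norm_incl (x : Γ.Omega) : ‖Γ.incl x‖ = 1 := USphere.norm_eq x.1

theorem mem_ballFamily_self (hne : Γ.IsNonelementary) {ε : ℝ} (hε : 0 < ε) (hε' : 4 * ε ≤ 1)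
    (x : Γ.Omega) : (x.1, ε * Γ.distLimit x) ∈ Γ.ballFamily ε := by
  refine ⟨mul_pos hε (distLimit_pos hne x), ?_, x, 1, Γ.group.one_mem, ?_⟩
  · have h1 := distLimit_le_two_mul_gap hne x
    have h2 := gap_le_two hne x.1
    have h3 := Real.pi_gt_three
    change ε * Γ.distLimit x < Real.pi
    nlinarith
  · exact image_id _

/-- The parameter `ε` is small enough for the radii of the balls of the family to be controlled
by the constant `C`. -/
structure IsAdmissible (Γ : KleinianGroup n) (C ε : ℝ) : Prop where
  nonelementary : Γ.IsNonelementary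
  pos : 0 < ε
  one_le : 1 ≤ C
  le : 4 * (C * ε) ≤ 1
  mem_cap : ∀ p ∈ Γ.ballFamily ε, ∀ x ∈ cap p.1 p.2,
    x ∈ regularSet Γ.group ∧ p.2 ≤ C * ε * Γ.gap x

namespace IsAdmissible

variable {C ε : ℝ} (h : Γ.IsAdmissible C ε)

include h

theorem four_mul_le : 4 * ε ≤ 1 := by nlinarith [h.le, h.one_le, h.pos]

theorem nonempty : (Γ.ballFamily ε).Nonempty := by
  obtain ⟨x, hx⟩ := Γ.regularSet_nonempty
  exact ⟨_, mem_ballFamily_self h.nonelementary h.pos h.four_mul_le ⟨x, hx⟩⟩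

/-- A cap contains its centre, so the bound of the radius applies there, with gap ≤ 2 and Cε ≤ 1/4.
-/
theorem radius_le_one {p : USphere n × ℝ} (hp : p ∈ Γ.ballFamily ε) : p.2 ≤ 1 := by
  have hc : p.1 ∈ cap p.1 p.2 := by
    rw [mem_cap_iff hp.1.le hp.2.1.le, real_inner_self_eq_norm_sq, USphere.norm_eq]
    simpa using Real.cos_lt_cos_of_nonneg_of_le_pi le_rfl hp.2.1.le hp.1
  have h1 := (h.mem_cap p hp p.1 hc).2
  nlinarith [gap_le_two h.nonelementary p.1, Γ.gap_nonneg p.1, h.le, h.pos, h.one_le]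

theorem half_le_cos (p : USphere n × ℝ) (hp : p ∈ Γ.ballFamily ε) : 1 / 2 ≤ Real.cos p.2 := by
  have h1 := h.radius_le_one hp
  have h2 := Real.one_sub_sq_div_two_le_cos (x := p.2)
  nlinarith [hp.1]

theorem inv_cos_le {p : USphere n × ℝ} (hp : p ∈ Γ.ballFamily ε) :
    1 / Real.cos p.2 ≤ 1 + p.2 ^ 2 := by
  have h1 := h.radius_le_one hp
  have h2 := Real.one_sub_sq_div_two_le_cos (x := p.2)
  have h0 := hp.1
  rw [div_le_iff₀ (by linarith [h.half_le_cos p hp])]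
  have h3 : p.2 ^ 2 ≤ 1 := by nlinarith
  nlinarith [sq_nonneg p.2]

/-- This localizes the supremum: a cap contributes more than 1 at x only if it contains x, and then
its radius is controlled by the gap at x. -/
theorem mem_cap_of_one_lt {p : USphere n × ℝ} (hp : p ∈ Γ.ballFamily ε) {x : USphere n}
    (hx : 1 < inner ℝ (p.1 : ESpace n) (x : ESpace n) / Real.cos p.2) : x ∈ cap p.1 p.2 := by
  rw [mem_cap_iff hp.1.le hp.2.1.le]
  rwa [one_lt_div (by linarith [h.half_le_cos p hp])] at hx

theorem inner_div_cos_le {p : USphere n × ℝ} (hp : p ∈ Γ.ballFamily ε) (x : USphere n) :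
    inner ℝ (p.1 : ESpace n) (x : ESpace n) / Real.cos p.2 ≤ 1 + p.2 ^ 2 := by
  refine le_trans ?_ (h.inv_cos_le hp)
  have : 0 ≤ Real.cos p.2 := by linarith [h.half_le_cos p hp]
  have h1 := real_inner_le_norm (p.1 : ESpace n) (x : ESpace n)
  rw [USphere.norm_eq, USphere.norm_eq, one_mul] at h1
  gcongr

theorem level_le (x : Γ.Omega) : Γ.level ε x ≤ 1 + (C * ε * Γ.gap x) ^ 2 := by
  have := h.nonempty.to_subtype
  refine ciSup_le fun p => ?_
  by_cases h1 : 1 < inner ℝ (p.1.1 : ESpace n) (Γ.incl x) / Real.cos p.1.2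
  · refine (h.inner_div_cos_le p.2 x.1).trans ?_
    have h2 := (h.mem_cap p.1 p.2 x.1 (h.mem_cap_of_one_lt p.2 h1)).2
    have h3 := p.2.1
    gcongr
  · nlinarith [sq_nonneg (C * ε * Γ.gap x)]

theorem level_le_two (x : Γ.Omega) : Γ.level ε x ≤ 2 := by
  refine (h.level_le x).trans ?_
  have h1 := gap_le_two h.nonelementary x.1
  have h2 := Γ.gap_nonneg x.1
  have h3 : 0 < C * ε := mul_pos (by linarith [h.one_le]) h.pos
  have h4 := h.le
  have h5 : C * ε * Γ.gap x ≤ 1 := by nlinarith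
  have h6 : 0 ≤ C * ε * Γ.gap x := by positivity
  nlinarith

/-- The ball of the family centred at x, of angular radius θ, contributes 1/cos θ ≥ √(1 + θ²). -/
theorem one_add_sq_le_level_sq (x : Γ.Omega) : 1 + (ε * Γ.gap x) ^ 2 ≤ Γ.level ε x ^ 2 := by
  have hne := h.nonelementary
  have hp := mem_ballFamily_self hne h.pos h.four_mul_le x
  have h1 := le_supportFun h.half_le_cos hp (Γ.incl x)
  change _ ≤ Γ.level ε x at h1
  have h2 : inner ℝ ((x.1 : USphere n) : ESpace n) (Γ.incl x) = (1 : ℝ) := by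
    rw [incl, real_inner_self_eq_norm_sq, USphere.norm_eq, one_pow]
  dsimp only at h1
  rw [h2] at h1
  set θ := ε * Γ.distLimit x with hθ
  have hθ0 : 0 < θ := mul_pos h.pos (distLimit_pos hne x)
  have hθ1 : θ ≤ 1 := h.radius_le_one hp
  have hc : 1 / 2 ≤ Real.cos θ := h.half_le_cos _ hp
  have h3 := Real.cos_le_one_div_sqrt_sq_add_one (x := θ) (by linarith [Real.pi_pos])
    (by linarith [Real.pi_gt_three])
  have h4 : 0 < √(θ ^ 2 + 1) := by positivity
  have h5 : √(θ ^ 2 + 1) ≤ 1 / Real.cos θ := by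
    rw [le_div_iff₀ (by linarith)]
    rw [le_div_iff₀ h4] at h3
    linarith
  have h6 : √(θ ^ 2 + 1) ≤ Γ.level ε x := h5.trans h1
  have h7 : √(θ ^ 2 + 1) ^ 2 = θ ^ 2 + 1 := Real.sq_sqrt (by positivity)
  have h8 : √(θ ^ 2 + 1) ^ 2 ≤ Γ.level ε x ^ 2 := by gcongr
  have h9 : ε * Γ.gap x ≤ θ := by
    rw [hθ]
    exact mul_le_mul_of_nonneg_left (gap_le_distLimit hne x) h.pos.le
  have h10 : (ε * Γ.gap x) ^ 2 ≤ θ ^ 2 := by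
    have := mul_nonneg h.pos.le (Γ.gap_nonneg x.1)
    gcongr
  linarith

theorem level_pos (x : Γ.Omega) : 0 < Γ.level ε x := by
  have hp := mem_ballFamily_self h.nonelementary h.pos h.four_mul_le x
  have h1 := le_supportFun h.half_le_cos hp (Γ.incl x)
  refine lt_of_lt_of_le ?_ h1
  have h2 : inner ℝ ((x.1 : USphere n) : ESpace n) (Γ.incl x) = (1 : ℝ) := by
    rw [incl, real_inner_self_eq_norm_sq, USphere.norm_eq, one_pow]
  dsimp only
  rw [h2]
  exact div_pos one_pos (by linarith [h.half_le_cos _ hp])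

theorem one_lt_level (x : Γ.Omega) : 1 < Γ.level ε x := by
  have h1 := h.one_add_sq_le_level_sq x
  have h2 := h.level_pos x
  have h3 := mul_pos h.pos (gap_pos h.nonelementary x)
  by_contra! h4
  nlinarith

theorem gap_le_sqrt (x : Γ.Omega) : ε * Γ.gap x ≤ √(Γ.level ε x ^ 2 - 1) :=
  Real.le_sqrt_of_sq_le (by linarith [h.one_add_sq_le_level_sq x])

theorem sqrt_pos (x : Γ.Omega) : 0 < √(Γ.level ε x ^ 2 - 1) :=
  (mul_pos h.pos (gap_pos h.nonelementary x)).trans_le (h.gap_le_sqrt x)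

theorem sq_sqrt (x : Γ.Omega) : √(Γ.level ε x ^ 2 - 1) ^ 2 = Γ.level ε x ^ 2 - 1 :=
  Real.sq_sqrt (by nlinarith [h.one_lt_level x])

theorem sqrt_le (x : Γ.Omega) : √(Γ.level ε x ^ 2 - 1) ≤ 2 * (C * ε * Γ.gap x) := by
  have h0 : 0 ≤ C * ε * Γ.gap x :=
    mul_nonneg (mul_nonneg (by linarith [h.one_le]) h.pos.le) (Γ.gap_nonneg _)
  refine Real.sqrt_le_iff.2 ⟨by positivity, ?_⟩
  nlinarith [h.level_le x, h.level_le_two x, h.one_lt_level x]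

/-- A Lipschitz constant of the order of the gap is needed, because `radius` contains a square root
that is itself only of the order of the gap. On the sphere the slope of ⟨c, ·⟩ near x is about |x −
c|, at most r for the caps that matter. -/
theorem level_sub_le (x y : Γ.Omega) :
    Γ.level ε x - Γ.level ε y ≤ 3 * (C * ε * Γ.gap x) * dist x.1 y.1 := by
  have := h.nonempty.to_subtype
  rw [sub_le_iff_le_add]
  refine ciSup_le fun p => ?_
  obtain ⟨⟨c, r⟩, hp⟩ := p
  dsimp only
  have hgx : 0 ≤ C * ε * Γ.gap x :=
    mul_nonneg (mul_nonneg (by linarith [h.one_le]) h.pos.le) (Γ.gap_nonneg _)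
  have hd : 0 ≤ dist x.1 y.1 := dist_nonneg
  -- Only a term above `level` at y, hence above 1, needs an estimate; its cap contains x.
  by_cases h1 : inner ℝ (c : ESpace n) (Γ.incl x) / Real.cos r ≤ Γ.level ε y
  · have : 0 ≤ 3 * (C * ε * Γ.gap x) * dist x.1 y.1 := by positivity
    linarith
  push Not at h1
  have hx := h.mem_cap_of_one_lt hp ((h.one_lt_level y).trans h1)
  have hr := (h.mem_cap _ hp x.1 hx).2
  have hr0 : 0 < r := hp.1
  have hcos : 1 / 2 ≤ Real.cos r := h.half_le_cos _ hp
  dsimp only at hr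
  suffices H : inner ℝ (c : ESpace n) (Γ.incl x) / Real.cos r - Γ.level ε y ≤
      3 * r * dist x.1 y.1 by
    have : 3 * r * dist x.1 y.1 ≤ 3 * (C * ε * Γ.gap x) * dist x.1 y.1 := by gcongr
    linarith
  rcases le_total (dist x.1 y.1) r with hxy | hxy
  · have h2 := le_supportFun h.half_le_cos hp (Γ.incl y)
    change _ ≤ Γ.level ε y at h2
    dsimp only at h2
    have h3 : inner ℝ (c : ESpace n) (Γ.incl x) - inner ℝ (c : ESpace n) (Γ.incl y) ≤
        3 / 2 * r * dist x.1 y.1 := by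
      have e1 : inner ℝ (c : ESpace n) (Γ.incl x) - inner ℝ (c : ESpace n) (Γ.incl y) =
          inner ℝ ((c : ESpace n) - Γ.incl x) (Γ.incl x - Γ.incl y) +
            inner ℝ (Γ.incl x) (Γ.incl x - Γ.incl y) := by
        rw [← inner_add_left, sub_add_cancel, inner_sub_right]
      have e2 : inner ℝ (Γ.incl x) (Γ.incl x - Γ.incl y) = dist x.1 y.1 ^ 2 / 2 := by
        rw [USphere.dist_sq, inner_sub_right, real_inner_self_eq_norm_sq, norm_incl]
        simp only [incl]
        ring
      have e3 : inner ℝ ((c : ESpace n) - Γ.incl x) (Γ.incl x - Γ.incl y) ≤ r * dist x.1 y.1 := by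
        refine (real_inner_le_norm _ _).trans ?_
        have e4 : ‖(c : ESpace n) - Γ.incl x‖ ≤ r := by
          have := (dist_le_sphereDist c x.1).trans (le_of_lt hx)
          rwa [Subtype.dist_eq, dist_eq_norm] at this
        have e5 : ‖Γ.incl x - Γ.incl y‖ = dist x.1 y.1 := by
          rw [Subtype.dist_eq, dist_eq_norm]
          rfl
        rw [e5]
        gcongr
      rw [e1, e2]
      nlinarith
    have h4 : inner ℝ (c : ESpace n) (Γ.incl x) / Real.cos r -
        inner ℝ (c : ESpace n) (Γ.incl y) / Real.cos r ≤ 3 * r * dist x.1 y.1 := by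
      rw [← sub_div, div_le_iff₀ (by linarith)]
      have : 0 ≤ 3 * r * dist x.1 y.1 := by positivity
      nlinarith
    linarith
  -- If y is at distance at least r, no slope is needed: the term exceeds 1 by at most r² ≤ r|x −
  -- y|, and `level` at y exceeds 1.
  · have h2 := h.inner_div_cos_le hp x.1
    have h3 := h.one_lt_level y
    change inner ℝ (c : ESpace n) (Γ.incl x) / Real.cos r ≤ 1 + r ^ 2 at h2
    nlinarith

theorem abs_level_sub_le (x y : Γ.Omega) :
    |Γ.level ε x - Γ.level ε y| ≤ 3 * (C * ε * (Γ.gap x + Γ.gap y)) * dist x.1 y.1 := by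
  have hd : 0 ≤ dist x.1 y.1 := dist_nonneg
  have hC : 0 ≤ C * ε := mul_nonneg (by linarith [h.one_le]) h.pos.le
  have h1 : 0 ≤ 3 * (C * ε * Γ.gap x) * dist x.1 y.1 := by
    have := Γ.gap_nonneg x.1
    positivity
  have h2 : 0 ≤ 3 * (C * ε * Γ.gap y) * dist x.1 y.1 := by
    have := Γ.gap_nonneg y.1
    positivity
  have h3 := h.level_sub_le x y
  have h4 := h.level_sub_le y x
  rw [dist_comm] at h4
  rw [abs_sub_le_iff]
  constructor <;> linarith

/-- From s² = a² − 1 and t² = b² − 1 comes (s − t)(s + t) = (a − b)(a + b). Since s + t ≥ ε(gap x +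
gap y), the gaps in the bound of |a − b| cancel. The roots contribute 12C and the levels 6C. -/
theorem abs_radius_sub_le (x y : Γ.Omega) :
    |Γ.radius ε x - Γ.radius ε y| ≤ 18 * C * dist x.1 y.1 := by
  have h1 := h.abs_level_sub_le x y
  have hd : 0 ≤ dist x.1 y.1 := dist_nonneg
  have hC := h.one_le
  have hx := gap_pos h.nonelementary x
  have hy := gap_pos h.nonelementary y
  have sx := h.gap_le_sqrt x
  have sy := h.gap_le_sqrt y
  have qx := h.sq_sqrt x
  have qy := h.sq_sqrt y
  have lx := h.level_le_two x
  have ly := h.level_le_two y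
  have ox := h.one_lt_level x
  have oy := h.one_lt_level y
  unfold radius
  set a := Γ.level ε x
  set b := Γ.level ε y
  set s := √(a ^ 2 - 1)
  set t := √(b ^ 2 - 1)
  set g := Γ.gap x + Γ.gap y with hg
  have hg0 : 0 < g := by positivity
  have hst : ε * g ≤ s + t := by rw [hg]; linarith
  have hεg : 0 < ε * g := mul_pos h.pos hg0
  have h2 : |s - t| * (s + t) = |a - b| * (a + b) := by
    rw [← abs_of_pos (by linarith : 0 < s + t), ← abs_of_pos (by linarith : 0 < a + b), ← abs_mul,
      ← abs_mul]
    congr 1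
    linear_combination qx - qy
  have hB : 0 ≤ 3 * (C * ε * g) * dist x.1 y.1 := (abs_nonneg _).trans h1
  have h3 : |s - t| * (ε * g) ≤ 12 * C * dist x.1 y.1 * (ε * g) := by
    calc |s - t| * (ε * g) ≤ |s - t| * (s + t) := by gcongr
      _ = |a - b| * (a + b) := h2
      _ ≤ (3 * (C * ε * g) * dist x.1 y.1) * 4 := by gcongr; linarith
      _ = 12 * C * dist x.1 y.1 * (ε * g) := by ring
  have h4 : |s - t| ≤ 12 * C * dist x.1 y.1 := le_of_mul_le_mul_right h3 hεg
  have h5 : |a - b| ≤ 6 * C * dist x.1 y.1 := by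
    refine h1.trans ?_
    have h6 : g ≤ 4 := by
      rw [hg]
      linarith [gap_le_two h.nonelementary x.1, gap_le_two h.nonelementary y.1]
    have h7 : C * ε * g ≤ 2 * C := by
      have h8 : ε * g ≤ 1 := by nlinarith [h.four_mul_le, h.pos]
      nlinarith
    calc 3 * (C * ε * g) * dist x.1 y.1 ≤ 3 * (2 * C) * dist x.1 y.1 := by gcongr
      _ = 6 * C * dist x.1 y.1 := by ring
  have h6 : |a - s - (b - t)| ≤ |a - b| + |s - t| := by
    rw [show a - s - (b - t) = (a - b) - (s - t) by ring]
    exact abs_sub _ _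
  linarith

/-- The two roots of t² − 2at + 1 have product 1, so bounds for the larger one become bounds for
`radius`. -/
theorem radius_mul_add (x : Γ.Omega) :
    Γ.radius ε x * (Γ.level ε x + √(Γ.level ε x ^ 2 - 1)) = 1 := by
  unfold radius
  linear_combination - h.sq_sqrt x

theorem sqrt_le_level (x : Γ.Omega) : √(Γ.level ε x ^ 2 - 1) ≤ Γ.level ε x :=
  Real.sqrt_le_iff.2 ⟨(h.level_pos x).le, by linarith⟩

theorem quarter_le_radius (x : Γ.Omega) : 1 / 4 ≤ Γ.radius ε x := by
  have h1 := h.radius_mul_add x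
  have h2 := h.sqrt_le_level x
  have h3 := h.level_le_two x
  have h4 : 0 ≤ Γ.radius ε x := sub_nonneg.2 h2
  nlinarith

theorem radius_lt_one (x : Γ.Omega) : Γ.radius ε x < 1 := by
  have h1 := h.radius_mul_add x
  have h2 := h.sqrt_pos x
  have h3 := h.one_lt_level x
  have h4 := h.quarter_le_radius x
  nlinarith

theorem one_sub_radius_sq (x : Γ.Omega) :
    1 - Γ.radius ε x ^ 2 = 2 * √(Γ.level ε x ^ 2 - 1) * Γ.radius ε x := by
  unfold radius
  linear_combination h.sq_sqrt x

/-- Together with `one_sub_radius_sq_le`, this makes the hyperbolic density on the graph comparable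
with the inverse of the gap. -/
theorem mul_gap_le_one_sub_radius_sq (x : Γ.Omega) :
    ε / 2 * Γ.gap x ≤ 1 - Γ.radius ε x ^ 2 := by
  rw [h.one_sub_radius_sq]
  nlinarith [h.gap_le_sqrt x, h.quarter_le_radius x, mul_pos h.pos (gap_pos h.nonelementary x)]

theorem one_sub_radius_sq_le (x : Γ.Omega) :
    1 - Γ.radius ε x ^ 2 ≤ 4 * C * ε * Γ.gap x := by
  rw [h.one_sub_radius_sq]
  nlinarith [h.sqrt_le x, h.radius_lt_one x, h.sqrt_pos x, h.quarter_le_radius x]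

theorem graph_eq : Γ.graph ε =
    {z | ‖z‖ < 1 ∧ 1 + ‖z‖ ^ 2 = 2 * supportFun (Γ.ballFamily ε) z} :=
  frontier_iUnion_halfSpace_inter_ball h.half_le_cos h.nonempty

theorem norm_radius_smul (x : Γ.Omega) : ‖Γ.radius ε x • Γ.incl x‖ = Γ.radius ε x := by
  rw [norm_smul, norm_incl, mul_one, Real.norm_of_nonneg (by linarith [h.quarter_le_radius x])]

theorem radius_smul_mem_graph (x : Γ.Omega) : Γ.radius ε x • Γ.incl x ∈ Γ.graph ε := by
  rw [h.graph_eq]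
  have h0 := h.quarter_le_radius x
  refine ⟨by rw [h.norm_radius_smul]; exact h.radius_lt_one x, ?_⟩
  rw [h.norm_radius_smul, supportFun_smul (by linarith)]
  change _ = 2 * (_ * Γ.level ε x)
  unfold radius
  linear_combination h.sq_sqrt x

theorem exists_radius_smul_eq {z : ESpace n} (hz : z ∈ Γ.graph ε) :
    ∃ x : Γ.Omega, Γ.radius ε x • Γ.incl x = z := by
  rw [h.graph_eq] at hz
  obtain ⟨hz1, hz2⟩ := hz
  have hz0 : z ≠ 0 := by
    rintro rfl
    have := supportFun_smul (S := Γ.ballFamily ε) le_rfl (0 : ESpace n)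
    rw [smul_zero, zero_mul] at this
    rw [this] at hz2
    norm_num at hz2
  have hs : 0 < ‖z‖ := norm_pos_iff.2 hz0
  set y : USphere n := ⟨‖z‖⁻¹ • z, by simp [norm_smul, hs.ne']⟩ with hy
  have hzy : z = ‖z‖ • (y : ESpace n) := by simp [hy, smul_smul, hs.ne']
  have h1 : 1 + ‖z‖ ^ 2 = 2 * (‖z‖ * supportFun (Γ.ballFamily ε) y) := by
    rw [← supportFun_smul hs.le, ← hzy, hz2]
  -- As 1 + t² > 2t for t = ‖z‖ < 1, the support function exceeds 1 in the direction of z. So a cap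
  -- contains this direction, which therefore lies in Ω.
  have h2 : 1 < supportFun (Γ.ballFamily ε) (y : ESpace n) := by
    by_contra! hle
    nlinarith [mul_le_mul_of_nonneg_left hle hs.le, sq_nonneg (1 - ‖z‖)]
  obtain ⟨p, hp, hpy⟩ := (lt_supportFun_iff h.half_le_cos h.nonempty).1 h2
  have hyΩ := (h.mem_cap p hp y (h.mem_cap_of_one_lt hp hpy)).1
  refine ⟨⟨y, hyΩ⟩, ?_⟩
  have hr : Γ.radius ε ⟨y, hyΩ⟩ = ‖z‖ := by
    have e1 : supportFun (Γ.ballFamily ε) (y : ESpace n) = Γ.level ε ⟨y, hyΩ⟩ := rfl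
    rw [e1] at h1 h2
    have e2 := h.sq_sqrt ⟨y, hyΩ⟩
    have e3 := h.sqrt_pos ⟨y, hyΩ⟩
    unfold radius
    set a := Γ.level ε ⟨y, hyΩ⟩
    set s := √(a ^ 2 - 1)
    -- The norm of z is one of the roots a ± s; the larger one exceeds 1 and is excluded.
    have e4 : (a - ‖z‖ - s) * (a - ‖z‖ + s) = 0 := by linear_combination h1 - e2
    rcases mul_eq_zero.1 e4 with e | e
    · linarith
    · linarith
  rw [hr]
  exact hzy.symm

end IsAdmissible

theorem exists_isAdmissible (hne : Γ.IsNonelementary) (hcpt : CompactSpace Γ.Manifold) :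
    ∃ C ε₀ : ℝ, 0 < ε₀ ∧ ∀ ε, 0 < ε → ε < ε₀ → Γ.IsAdmissible C ε := by
  obtain ⟨C, hC, h⟩ := exists_ballFamily_radius_le hne hcpt
  have hC0 : 0 < C := by linarith
  refine ⟨C, 1 / (4 * C), by positivity, fun ε hε hε' => ?_⟩
  rw [lt_div_iff₀ (by positivity)] at hε'
  exact ⟨hne, hε, hC, by linarith, h ε hε (by nlinarith)⟩

end KleinianGroup

/-! ### Lengths of Lipschitz curves -/

section Length

variable {n : ℕ}

/-- Pairing the curve with the fixed chord e gives a scalar Lipschitz function, hence an absolutely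
continuous one. The fundamental theorem of calculus and Cauchy–Schwarz give ‖e‖² ≤ ‖e‖ · length. -/
theorem ofReal_norm_sub_le_lintegral {c : ℝ → ESpace n} {K : ℝ≥0} (hc : LipschitzWith K c) {t : ℝ}
    (ht : t ∈ Icc (0 : ℝ) 1) :
    ENNReal.ofReal ‖c t - c 0‖ ≤ ∫⁻ s in Icc (0 : ℝ) 1, ENNReal.ofReal ‖deriv c s‖ := by
  set e := c t - c 0 with he
  rcases eq_or_ne e 0 with h0 | h0
  · simp [h0]
  have he0 : 0 < ‖e‖ := norm_pos_iff.2 h0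
  have hg : LipschitzWith (‖e‖₊ * K) fun s => inner ℝ e (c s) := by
    refine LipschitzWith.of_dist_le_mul fun s s' => ?_
    rw [Real.dist_eq, ← inner_sub_right]
    refine (abs_real_inner_le_norm _ _).trans ?_
    rw [NNReal.coe_mul, coe_nnnorm, mul_assoc]
    gcongr
    rw [← dist_eq_norm]
    exact hc.dist_le_mul s s'
  have hftc := (hg.lipschitzOnWith (s := uIcc 0 t)).absolutelyContinuousOnInterval.integral_deriv_eq_sub
  have hmeas : Measurable fun s => ‖deriv c s‖ := (measurable_deriv c).norm
  have hint : IntegrableOn (fun s => ‖deriv c s‖) (Ioc 0 t) := by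
    refine Measure.integrableOn_of_bounded (M := K) (by simp) hmeas.aestronglyMeasurable ?_
    refine Eventually.of_forall fun s => ?_
    rw [norm_norm]
    exact norm_deriv_le_of_lipschitz hc
  have hle : ‖e‖ ^ 2 ≤ ‖e‖ * ∫ s in Ioc 0 t, ‖deriv c s‖ := by
    have h1 : ‖e‖ ^ 2 = ∫ s in (0 : ℝ)..t, deriv (fun s => inner ℝ e (c s)) s := by
      rw [hftc, ← inner_sub_right, ← he, real_inner_self_eq_norm_sq]
    rw [h1, intervalIntegral.integral_of_le ht.1, ← integral_const_mul]
    refine (Real.le_norm_self _).trans (norm_integral_le_of_norm_le (hint.const_mul _) ?_)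
    filter_upwards [ae_restrict_of_ae hc.ae_differentiableAt_real] with s hs
    have h2 : HasDerivAt (fun s => inner ℝ e (c s)) (inner ℝ e (deriv c s)) s :=
      (innerSL ℝ e).hasFDerivAt.comp_hasDerivAt s hs.hasDerivAt
    rw [h2.deriv]
    exact norm_inner_le_norm _ _
  have hle' : ‖e‖ ≤ ∫ s in Ioc 0 t, ‖deriv c s‖ := by
    rw [sq] at hle
    exact le_of_mul_le_mul_left hle he0
  calc ENNReal.ofReal ‖e‖ ≤ ENNReal.ofReal (∫ s in Ioc 0 t, ‖deriv c s‖) :=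
        ENNReal.ofReal_le_ofReal hle'
    _ = ∫⁻ s in Ioc 0 t, ENNReal.ofReal ‖deriv c s‖ :=
        ofReal_integral_eq_lintegral_ofReal hint (Eventually.of_forall fun _ => norm_nonneg _)
    _ ≤ ∫⁻ s in Icc (0 : ℝ) 1, ENNReal.ofReal ‖deriv c s‖ :=
        lintegral_mono_set fun s hs => ⟨hs.1.le, hs.2.trans ht.2⟩

theorem norm_deriv_le_mul_norm_deriv {c d : ℝ → ESpace n} {L : ℝ} (hL : 0 ≤ L)
    (h : ∀ s t, ‖d s - d t‖ ≤ L * ‖c s - c t‖) {t : ℝ} (hc : DifferentiableAt ℝ c t) :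
    ‖deriv d t‖ ≤ L * ‖deriv c t‖ := by
  by_cases hd : DifferentiableAt ℝ d t
  · have h1 := (hasDerivAt_iff_tendsto_slope.1 hd.hasDerivAt).norm
    have h2 := ((hasDerivAt_iff_tendsto_slope.1 hc.hasDerivAt).norm).const_mul L
    refine le_of_tendsto_of_tendsto' h1 h2 fun s => ?_
    rw [slope_def_module, slope_def_module, norm_smul, norm_smul]
    calc ‖(s - t)⁻¹‖ * ‖d s - d t‖ ≤ ‖(s - t)⁻¹‖ * (L * ‖c s - c t‖) := by gcongr; exact h s t
      _ = L * (‖(s - t)⁻¹‖ * ‖c s - c t‖) := by ring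
  -- Where d is not differentiable, its `deriv` is 0 by convention.
  · rw [deriv_zero_of_not_differentiableAt hd, norm_zero]
    positivity

/-- A Lipschitz map that increases the length element by a bounded factor increases the length
distance by a bounded factor. -/
theorem lengthEDist_map_le {X Y : Type*} {ι : X → ESpace n} {κ : Y → ESpace n} {ρ : X → ℝ}
    {σ : Y → ℝ} (T : X → Y) {L A : ℝ≥0} (hL : 0 < L) (hA : 0 < A)
    (hT : ∀ x x', ‖κ (T x) - κ (T x')‖ ≤ L * ‖ι x - ι x'‖) (hσ : ∀ x, σ (T x) ≤ A * ρ x)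
    (hρ : ∀ x, 0 ≤ ρ x) (p q : X) :
    lengthEDist κ σ (T p) (T q) ≤ (A * L : ℝ≥0) * lengthEDist ι ρ p q := by
  have hne : ((A * L : ℝ≥0) : ℝ≥0∞) ≠ 0 := by
    rw [ENNReal.coe_ne_zero]
    positivity
  rw [mul_comm, ← ENNReal.div_le_iff_le_mul (Or.inl hne) (Or.inl ENNReal.coe_ne_top)]
  refine le_iInf₂ fun c hc => le_iInf₂ fun h0 h1 => ?_
  rw [ENNReal.div_le_iff_le_mul (Or.inl hne) (Or.inl ENNReal.coe_ne_top), mul_comm]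
  obtain ⟨K, hK⟩ := hc
  have hlip : LipschitzWith (L * K) (κ ∘ T ∘ c) := by
    refine LipschitzWith.of_dist_le_mul fun s t => ?_
    rw [dist_eq_norm, NNReal.coe_mul, mul_assoc]
    refine (hT _ _).trans ?_
    gcongr
    rw [← dist_eq_norm]
    exact hK.dist_le_mul s t
  refine (iInf₂_le (T ∘ c) ⟨_, hlip⟩).trans ((iInf₂_le (by simp [h0]) (by simp [h1])).trans ?_)
  rw [← lintegral_const_mul' _ _ ENNReal.coe_ne_top]
  refine lintegral_mono_ae ?_
  filter_upwards [ae_restrict_of_ae hK.ae_differentiableAt_real] with t ht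
  have h2 := norm_deriv_le_mul_norm_deriv (d := κ ∘ T ∘ c) L.2 (fun s t => hT _ _) ht
  rw [ENNReal.coe_nnreal_eq, ← ENNReal.ofReal_mul (NNReal.coe_nonneg _)]
  refine ENNReal.ofReal_le_ofReal ?_
  have h3 := mul_nonneg A.2 (hρ (c t))
  calc σ ((T ∘ c) t) * ‖deriv (κ ∘ T ∘ c) t‖ ≤ (A * ρ (c t)) * (L * ‖deriv (ι ∘ c) t‖) := by
        gcongr
        · exact hσ _
        · exact h2
    _ = _ := by
        push_cast
        ring

theorem norm_normalize_sub_le {r : ℝ} (hr : 0 < r) {z w : ESpace n} (hz : r ≤ ‖z‖) (hw : w ≠ 0) :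
    ‖‖z‖⁻¹ • z - ‖w‖⁻¹ • w‖ ≤ 2 / r * ‖z - w‖ := by
  have hz0 : 0 < ‖z‖ := hr.trans_le hz
  have hw0 : 0 < ‖w‖ := norm_pos_iff.2 hw
  have e : ‖z‖⁻¹ • z - ‖w‖⁻¹ • w = ‖z‖⁻¹ • (z - w) + (‖z‖⁻¹ - ‖w‖⁻¹) • w := by
    module
  have h2 : ‖(‖z‖⁻¹ - ‖w‖⁻¹) • w‖ ≤ ‖z‖⁻¹ * ‖z - w‖ := by
    have e2 : ‖z‖⁻¹ - ‖w‖⁻¹ = ‖z‖⁻¹ * (‖w‖ - ‖z‖) * ‖w‖⁻¹ := by field_simp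
    rw [norm_smul, e2, norm_mul, norm_mul, norm_inv, norm_inv, norm_norm, norm_norm, mul_assoc,
      inv_mul_cancel₀ hw0.ne', mul_one]
    gcongr
    rw [norm_sub_rev z w]
    exact abs_norm_sub_norm_le w z
  calc ‖‖z‖⁻¹ • z - ‖w‖⁻¹ • w‖ ≤ ‖z‖⁻¹ * ‖z - w‖ + ‖z‖⁻¹ * ‖z - w‖ := by
        rw [e]
        refine (norm_add_le _ _).trans (add_le_add ?_ h2)
        rw [norm_smul, norm_inv, norm_norm]
    _ = 2 / ‖z‖ * ‖z - w‖ := by ring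
    _ ≤ 2 / r * ‖z - w‖ := by gcongr

end Length

/-! ### Completeness of length elements comparable with the inverse of the gap -/

namespace KleinianGroup

variable {n : ℕ} {Γ : KleinianGroup n}

theorem norm_incl_sub (x y : Γ.Omega) : ‖Γ.incl x - Γ.incl y‖ = dist x.1 y.1 := by
  rw [Subtype.dist_eq, dist_eq_norm]
  rfl

/-- If the length element is at least a multiple of the inverse of the distance to the limit set,
then points that are close for the length distance are close on the sphere. -/
theorem dist_le_of_conformalEDist_lt {u : Γ.Omega → ℝ} {K : ℝ} (hK : 0 < K)
    (hu : ∀ x : Γ.Omega, 1 ≤ K * Γ.gap x * Real.exp (u x)) {η : ℝ} (hη : 0 < η) (hKη : K * η ≤ 1 / 2)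
    {x y : Γ.Omega} (hxy : Γ.conformalEDist u x y < ENNReal.ofReal η) :
    dist x.1 y.1 ≤ 2 * (K * η) * Γ.gap x := by
  simp only [conformalEDist, lengthEDist, iInf_lt_iff] at hxy
  obtain ⟨c, ⟨L, hL⟩, h0, h1, hlt⟩ := hxy
  have hcont : Continuous fun t => ‖(Γ.incl ∘ c) t - Γ.incl x‖ :=
    (hL.continuous.sub continuous_const).norm
  -- Let m be the largest distance from x reached by the curve. Along the curve the gap is at most
  -- gap x + m, so m ≤ Kη(gap x + m), and Kη ≤ 1/2 absorbs m on the right.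
  obtain ⟨t₀, ht₀, hmax⟩ := (isCompact_Icc (a := (0 : ℝ)) (b := 1)).exists_isMaxOn
    (nonempty_Icc.2 zero_le_one) hcont.continuousOn
  set m := ‖(Γ.incl ∘ c) t₀ - Γ.incl x‖ with hm
  have hm0 : 0 ≤ m := norm_nonneg _
  have hg := Γ.gap_nonneg x.1
  have hgap : ∀ t ∈ Icc (0 : ℝ) 1, Γ.gap (c t) ≤ Γ.gap x + m := by
    intro t ht
    have h2 : ‖Γ.incl (c t) - Γ.incl x‖ ≤ m := hmax ht
    rw [norm_incl_sub] at h2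
    linarith [gap_le_gap_add_dist (Γ := Γ) (c t).1 x.1]
  have hlen := ofReal_norm_sub_le_lintegral hL ht₀
  have hB : 0 ≤ K * (Γ.gap x + m) := by positivity
  have h2 : ENNReal.ofReal m ≤ ENNReal.ofReal (K * (Γ.gap x + m)) * ENNReal.ofReal η := by
    have e0 : (Γ.incl ∘ c) 0 = Γ.incl x := congrArg Γ.incl h0
    rw [e0, ← hm] at hlen
    refine hlen.trans (le_trans ?_ (mul_le_mul_right hlt.le _))
    rw [← lintegral_const_mul' _ _ ENNReal.ofReal_ne_top]
    refine setLIntegral_mono' measurableSet_Icc fun t ht => ?_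
    rw [← ENNReal.ofReal_mul hB]
    refine ENNReal.ofReal_le_ofReal ?_
    rw [← mul_assoc]
    refine le_mul_of_one_le_left (norm_nonneg _) ((hu (c t)).trans ?_)
    have := hgap t ht
    gcongr
  rw [← ENNReal.ofReal_mul hB, ENNReal.ofReal_le_ofReal_iff (by positivity)] at h2
  have h3 : dist x.1 y.1 ≤ m := by
    have h4 : ‖Γ.incl (c 1) - Γ.incl x‖ ≤ m := hmax (right_mem_Icc.2 zero_le_one)
    rwa [h1, norm_incl_sub, dist_comm] at h4
  nlinarith

/-- If the length element is at most a multiple of the inverse of the distance to the limit set,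
then points that are close on the sphere are close for the length distance. -/
theorem conformalEDist_le_of_dist_le (hne : Γ.IsNonelementary) {u : Γ.Omega → ℝ} {K : ℝ}
    (hu : ∀ x : Γ.Omega, Γ.gap x * Real.exp (u x) ≤ K) {x y : Γ.Omega} (hxy : dist x.1 y.1 ≤ Γ.gap y / 4) :
    Γ.conformalEDist u x y ≤ ENNReal.ofReal (8 * K / Γ.gap y * dist x.1 y.1) := by
  have hg := gap_pos hne y
  have hg2 := gap_le_two hne y.1
  have hK : 0 < K := (mul_pos hg (Real.exp_pos (u y))).trans_le (hu y)
  -- The curve is the chord from x to y projected radially to the sphere, with the parameter clamped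
  -- to [0, 1]. It stays within gap y / 2 of y, so the gap along it is at least gap y / 2.
  set s : ℝ → ℝ := fun t => (projIcc (0 : ℝ) 1 zero_le_one t : ℝ) with hs
  have hsl : ∀ t t', |s t - s t'| ≤ |t - t'| := fun t t' => by
    have := (LipschitzWith.projIcc (zero_le_one (α := ℝ))).dist_le_mul t t'
    rwa [NNReal.coe_one, one_mul, Subtype.dist_eq, Real.dist_eq, Real.dist_eq] at this
  have hs01 : ∀ t, 0 ≤ s t ∧ s t ≤ 1 := fun t => (projIcc (0 : ℝ) 1 zero_le_one t).2
  set w : ℝ → ESpace n := fun t => Γ.incl y + (1 - s t) • (Γ.incl x - Γ.incl y) with hw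
  have hwy : ∀ t, ‖Γ.incl y - w t‖ ≤ dist x.1 y.1 := fun t => by
    have : Γ.incl y - w t = -((1 - s t) • (Γ.incl x - Γ.incl y)) := by simp [hw]
    rw [this, norm_neg, norm_smul, norm_incl_sub, Real.norm_of_nonneg (by linarith [hs01 t])]
    exact mul_le_of_le_one_left dist_nonneg (by linarith [hs01 t])
  have hwn : ∀ t, 1 / 2 ≤ ‖w t‖ := fun t => by
    have h1 := norm_sub_norm_le (Γ.incl y) (w t)
    rw [norm_incl] at h1
    linarith [hwy t]
  have hw0 : ∀ t, w t ≠ 0 := fun t h => by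
    have := hwn t
    rw [h, norm_zero] at this
    linarith
  have hwl : ∀ t t', ‖w t - w t'‖ ≤ dist x.1 y.1 * |t - t'| := fun t t' => by
    have : w t - w t' = (s t' - s t) • (Γ.incl x - Γ.incl y) := by
      simp only [hw]
      module
    rw [this, norm_smul, norm_incl_sub, mul_comm, Real.norm_eq_abs, abs_sub_comm]
    exact mul_le_mul_of_nonneg_left (hsl t t') dist_nonneg
  set v : ℝ → USphere n := fun t => ⟨‖w t‖⁻¹ • w t, by simp [norm_smul, hw0 t]⟩ with hv
  have hvy : ∀ t, dist y.1 (v t) ≤ Γ.gap y / 2 := fun t => by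
    have h1 := norm_normalize_sub_le one_pos (norm_incl y).ge (hw0 t)
    rw [norm_incl, inv_one, one_smul] at h1
    rw [Subtype.dist_eq, dist_eq_norm]
    refine h1.trans ?_
    linarith [hwy t]
  have hvg : ∀ t, Γ.gap y / 2 ≤ Γ.gap (v t) := fun t => by
    linarith [gap_le_gap_add_dist (Γ := Γ) y.1 (v t), hvy t]
  set c : ℝ → Γ.Omega := fun t => ⟨v t, (gap_pos_iff hne).1 (by linarith [hvg t])⟩ with hc
  have hcl : LipschitzWith (4 * dist x.1 y.1).toNNReal (Γ.incl ∘ c) := by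
    refine LipschitzWith.of_dist_le_mul fun t t' => ?_
    rw [Real.coe_toNNReal _ (by positivity), dist_eq_norm, Real.dist_eq]
    refine (norm_normalize_sub_le (by norm_num) (hwn t) (hw0 t')).trans ?_
    have := hwl t t'
    linarith
  have hc0 : c 0 = x := by
    refine Subtype.ext (Subtype.ext ?_)
    have : w 0 = Γ.incl x := by simp [hw, hs]
    simp only [hc, hv, this, norm_incl, inv_one, one_smul]
    rfl
  have hc1 : c 1 = y := by
    refine Subtype.ext (Subtype.ext ?_)
    have : w 1 = Γ.incl y := by simp [hw, hs]
    simp only [hc, hv, this, norm_incl, inv_one, one_smul]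
    rfl
  refine (iInf₂_le c ⟨_, hcl⟩).trans ((iInf₂_le hc0 hc1).trans ?_)
  have hbound : ∀ t, Real.exp (u (c t)) * ‖deriv (Γ.incl ∘ c) t‖ ≤
      8 * K / Γ.gap y * dist x.1 y.1 := by
    intro t
    have h1 := norm_deriv_le_of_lipschitz (x₀ := t) hcl
    rw [Real.coe_toNNReal _ (by positivity)] at h1
    have h2 : Real.exp (u (c t)) ≤ 2 * K / Γ.gap y := by
      rw [le_div_iff₀ hg]
      have h3 := hu (c t)
      have h4 : Γ.gap y / 2 * Real.exp (u (c t)) ≤ Γ.gap (c t) * Real.exp (u (c t)) :=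
        mul_le_mul_of_nonneg_right (hvg t) (Real.exp_pos _).le
      linarith
    calc Real.exp (u (c t)) * ‖deriv (Γ.incl ∘ c) t‖ ≤ 2 * K / Γ.gap y * (4 * dist x.1 y.1) := by
          gcongr
      _ = _ := by ring
  refine (lintegral_mono fun t => ENNReal.ofReal_le_ofReal (hbound t)).trans ?_
  simp

/-- A Cauchy sequence is also Cauchy for chords. Its limit is within a quarter of the gap of some
term, so it is not a limit point of Γ, and near a point of Ω chordal convergence implies convergence
in length. -/
theorem isCompleteMetric_of_comparable (hne : Γ.IsNonelementary) {u : Γ.Omega → ℝ} {K : ℝ}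
    (hl : ∀ x : Γ.Omega, 1 ≤ K * Γ.gap x * Real.exp (u x))
    (hu : ∀ x : Γ.Omega, Γ.gap x * Real.exp (u x) ≤ K) : Γ.IsCompleteMetric u := by
  intro x hx
  have hK : 0 < K := (mul_pos (gap_pos hne (x 0)) (Real.exp_pos (u (x 0)))).trans_le (hu (x 0))
  have hdist : ∀ η, 0 < η → K * η ≤ 1 / 2 →
      ∃ N, ∀ i ≥ N, ∀ j ≥ N, dist (x i).1 (x j).1 ≤ 2 * (K * η) * Γ.gap (x i) := by
    intro η hη hKη
    obtain ⟨N, hN⟩ := hx (ENNReal.ofReal η) (ENNReal.ofReal_pos.2 hη)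
    exact ⟨N, fun i hi j hj => dist_le_of_conformalEDist_lt hK hl hη hKη (hN i hi j hj)⟩
  have hcau : CauchySeq fun i => (x i).1 := by
    refine Metric.cauchySeq_iff'.2 fun δ hδ => ?_
    have hη : 0 < min (1 / (2 * K)) (δ / (8 * K)) := by positivity
    obtain ⟨N, hN⟩ := hdist _ hη (by
      calc K * min (1 / (2 * K)) (δ / (8 * K)) ≤ K * (1 / (2 * K)) := by
            gcongr
            exact min_le_left _ _
        _ = 1 / 2 := by field_simp)
    refine ⟨N, fun i hi => (hN i hi N le_rfl).trans_lt ?_⟩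
    have h1 : K * min (1 / (2 * K)) (δ / (8 * K)) ≤ δ / 8 := by
      calc K * min (1 / (2 * K)) (δ / (8 * K)) ≤ K * (δ / (8 * K)) := by
            gcongr
            exact min_le_right _ _
        _ = δ / 8 := by field_simp
    have h2 := gap_le_two hne (x i).1
    have h3 := Γ.gap_nonneg (x i).1
    nlinarith
  obtain ⟨y, hy⟩ := cauchySeq_tendsto_of_complete hcau
  -- This η makes 2Kη = 1/4.
  obtain ⟨N, hN⟩ := hdist (1 / (8 * K)) (by positivity) (by
    rw [mul_one_div, div_le_iff₀ (by positivity)]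
    linarith)
  have hlim : dist (x N).1 y ≤ Γ.gap (x N) / 4 := by
    refine le_of_tendsto (tendsto_const_nhds.dist hy) (eventually_atTop.2 ⟨N, fun j hj => ?_⟩)
    refine (hN N le_rfl j hj).trans (le_of_eq ?_)
    field_simp
    ring
  have hgN := gap_pos hne (x N)
  have hgy : 0 < Γ.gap y := by
    linarith [gap_le_gap_add_dist (Γ := Γ) (x N).1 y]
  refine ⟨⟨y, (gap_pos_iff hne).1 hgy⟩, ?_⟩
  have hd0 : Tendsto (fun i => dist (x i).1 y) atTop (𝓝 0) := by
    simpa using hy.dist (tendsto_const_nhds (x := y))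
  have ht : Tendsto (fun i => ENNReal.ofReal (8 * K / Γ.gap y * dist (x i).1 y)) atTop (𝓝 0) := by
    have := ENNReal.tendsto_ofReal (hd0.const_mul (8 * K / Γ.gap y))
    simpa using this
  refine tendsto_of_tendsto_of_tendsto_of_le_of_le' tendsto_const_nhds ht
    (Eventually.of_forall fun _ => zero_le) ?_
  filter_upwards [hd0.eventually_le_const (show 0 < Γ.gap y / 4 by linarith)] with i hi
  exact conformalEDist_le_of_dist_le hne hu hi

end KleinianGroup

/-! ### Conformal metrics on the Kleinian manifold -/

theorem mvfderiv_comp_eq {n : ℕ} {M N E : Type*} [TopologicalSpace M] [TopologicalSpace N]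
    [ChartedSpace (EuclideanSpace ℝ (Fin n)) M] [ChartedSpace (EuclideanSpace ℝ (Fin n)) N]
    [NormedAddCommGroup E] [NormedSpace ℝ E] {g : N → E} {f : M → N} {x : M}
    (hg : MDifferentiableAt (𝓡 n) 𝓘(ℝ, E) g (f x)) (hf : MDifferentiableAt (𝓡 n) (𝓡 n) f x)
    (a : TangentSpace (𝓡 n) x) :
    mvfderiv (𝓡 n) (g ∘ f) x a = mvfderiv (𝓡 n) g (f x) (mfderiv (𝓡 n) (𝓡 n) f x a) :=
  mfderiv_comp_apply x hg hf a

/-- If two maps differ by a conformal distortion of distances from a point, then so do their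
derivatives at this point. -/
theorem norm_mvfderiv_eq_of_norm_sub_sq {n : ℕ} {M E : Type*} [TopologicalSpace M]
    [ChartedSpace (EuclideanSpace ℝ (Fin n)) M] [NormedAddCommGroup E] [NormedSpace ℝ E]
    {f h : M → E} {j : M → ℝ} {x : M} (hf : MDifferentiableAt (𝓡 n) 𝓘(ℝ, E) f x)
    (hh : MDifferentiableAt (𝓡 n) 𝓘(ℝ, E) h x) (hj : ContinuousAt j x) (hj0 : 0 ≤ j x)
    (hfh : ∀ y, ‖h y - h x‖ ^ 2 = j y * j x * ‖f y - f x‖ ^ 2) (a : EuclideanSpace ℝ (Fin n)) :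
    ‖mvfderiv (𝓡 n) h x a‖ = j x * ‖mvfderiv (𝓡 n) f x a‖ := by
  set φ := extChartAt (𝓡 n) x with hφ
  have hline : HasDerivAt (fun s : ℝ => φ x + s • a) a 0 := by
    simpa using ((hasDerivAt_id (0 : ℝ)).smul_const a).const_add (φ x)
  have hsymm : φ.symm (φ x) = x := extChartAt_to_inv x
  -- Squared difference quotients along a coordinate line converge to the squared norm of the
  -- derivative. The distortion identity holds for each quotient and passes to the limit since j is
  -- continuous.
  have key : ∀ k : M → E, MDifferentiableAt (𝓡 n) 𝓘(ℝ, E) k x →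
      Tendsto (fun s : ℝ => ‖s⁻¹ • (k (φ.symm (φ x + s • a)) - k x)‖ ^ 2) (𝓝[≠] 0)
        (𝓝 (‖mvfderiv (𝓡 n) k x a‖ ^ 2)) := by
    intro k hk
    obtain ⟨A, hA, h1⟩ : ∃ A : EuclideanSpace ℝ (Fin n) →L[ℝ] E,
        A a = mvfderiv (𝓡 n) k x a ∧
          HasFDerivWithinAt (k ∘ φ.symm) A (range (𝓡 n)) (φ x) :=
      ⟨mvfderiv (𝓡 n) k x, rfl, hk.hasMFDerivAt.2⟩
    rw [← hA]
    rw [ModelWithCorners.range_eq_univ, hasFDerivWithinAt_univ] at h1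
    have h2 : HasDerivAt (fun s : ℝ => (k ∘ φ.symm) (φ x + s • a)) (A a) 0 := by
      have h1' : HasFDerivAt (k ∘ φ.symm) A (φ x + (0 : ℝ) • a) := by rwa [zero_smul, add_zero]
      exact h1'.comp_hasDerivAt (0 : ℝ) hline
    have h3 := ((hasDerivAt_iff_tendsto_slope.1 h2).norm).pow 2
    refine h3.congr fun s => ?_
    rw [slope_def_module, sub_zero, zero_smul, add_zero, Function.comp_apply, Function.comp_apply,
      hsymm]
  have hcont : Tendsto (fun s : ℝ => j (φ.symm (φ x + s • a)) * j x) (𝓝[≠] 0) (𝓝 (j x * j x)) := by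
    refine Tendsto.mul_const _ ?_
    have h1 : Tendsto (fun s : ℝ => φ x + s • a) (𝓝[≠] 0) (𝓝 (φ x)) := by
      have := hline.continuousAt.tendsto.mono_left (nhdsWithin_le_nhds (s := {0}ᶜ))
      simpa using this
    have h2 : Tendsto φ.symm (𝓝 (φ x)) (𝓝 x) := by
      have := (continuousAt_extChartAt_symm (I := 𝓡 n) x).tendsto
      rwa [extChartAt_to_inv] at this
    exact hj.tendsto.comp (h2.comp h1)
  have h4 := tendsto_nhds_unique (key h hh) ((hcont.mul (key f hf)).congr fun s => by
    rw [norm_smul, norm_smul, mul_pow, mul_pow, hfh]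
    ring)
  refine (pow_left_inj₀ (norm_nonneg _) (by positivity) two_ne_zero).1 ?_
  rw [h4]
  ring

namespace KleinianGroup

variable {n : ℕ} {Γ : KleinianGroup n}

theorem contMDiff_incl : ContMDiff (𝓡 n) 𝓘(ℝ, ESpace n) ∞ Γ.incl := by
  have : Fact (Module.finrank ℝ (ESpace n) = n + 1) := ⟨by simp⟩
  exact (contMDiff_coe_sphere (n := n)).comp contMDiff_subtype_val

theorem mdifferentiableAt_incl (x : Γ.Omega) :
    MDifferentiableAt (𝓡 n) 𝓘(ℝ, ESpace n) Γ.incl x :=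
  (contMDiff_incl x).mdifferentiableAt (by simp)

theorem mdifferentiableAt_smul (γ : Γ.group) (x : Γ.Omega) :
    MDifferentiableAt (𝓡 n) (𝓡 n) (fun y : Γ.Omega => γ • y) x :=
  (Γ.contMDiff_smul γ x).mdifferentiableAt (by simp)

theorem injective_mvfderiv_incl (x : Γ.Omega) :
    Function.Injective (mvfderiv (𝓡 n) Γ.incl x) := by
  have : Fact (Module.finrank ℝ (ESpace n) = n + 1) := ⟨by simp⟩
  have hval : MDifferentiableAt (𝓡 n) (𝓡 n) (Subtype.val : Γ.Omega → USphere n) x :=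
    (contMDiff_subtype_val (n := ∞) x).mdifferentiableAt (by simp)
  have hcoe : MDifferentiableAt (𝓡 n) 𝓘(ℝ, ESpace n) (Subtype.val : USphere n → ESpace n) x.1 :=
    (contMDiff_coe_sphere (n := n) (m := ∞) x.1).mdifferentiableAt (by simp)
  have h1 : ∀ a, mvfderiv (𝓡 n) Γ.incl x a =
      mvfderiv (𝓡 n) (Subtype.val : USphere n → ESpace n) x.1
        (mfderiv (𝓡 n) (𝓡 n) (Subtype.val : Γ.Omega → USphere n) x a) :=
    mvfderiv_comp_eq hcoe hval
  have h2 : Function.Injective (mfderiv (𝓡 n) (𝓡 n) (Subtype.val : Γ.Omega → USphere n) x) := by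
    have h3 : MDifferentiableAt (𝓡 n) 𝓘(ℝ, EuclideanSpace ℝ (Fin n)) (extChartAt (𝓡 n) x.1) x.1 :=
      mdifferentiableAt_extChartAt (mem_chart_source _ _)
    have h4 := mfderiv_comp x h3 hval
    -- The chart of the open subset is the restriction of the chart of the sphere, so its invertible
    -- derivative factors through that of the inclusion.
    have h5 : (extChartAt (𝓡 n) x.1) ∘ (Subtype.val : Γ.Omega → USphere n) = extChartAt (𝓡 n) x := by
      rfl
    rw [h5] at h4
    have h6 := (isInvertible_mfderiv_extChartAt (I := 𝓡 n) (mem_extChartAt_source x)).injective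
    rw [h4] at h6
    exact Function.Injective.of_comp (f := mfderiv (𝓡 n) 𝓘(ℝ, EuclideanSpace ℝ (Fin n))
      (extChartAt (𝓡 n) x.1) x.1) h6
  rw [show ⇑(mvfderiv (𝓡 n) Γ.incl x) = _ from funext h1]
  exact (injective_mvfderiv_subtypeVal_sphere x.1).comp h2

/-- In dimension at least 1 there is a nonzero tangent vector; testing on it recovers the exponent u
from the metric. -/
theorem exists_roundMetric_pos (hn : 1 ≤ n) (x : Γ.Omega) :
    ∃ a : TangentSpace (𝓡 n) x, 0 < Γ.roundMetric x a a := by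
  have hex : ∃ a : EuclideanSpace ℝ (Fin n), a ≠ 0 := ⟨EuclideanSpace.single ⟨0, hn⟩ 1, by simp⟩
  obtain ⟨a, ha⟩ : ∃ a : TangentSpace (𝓡 n) x, a ≠ 0 := hex
  refine ⟨a, ?_⟩
  rw [roundMetric, real_inner_self_eq_norm_sq]
  have : mvfderiv (𝓡 n) Γ.incl x a ≠ 0 := fun h =>
    ha (injective_mvfderiv_incl x (h.trans (map_zero _).symm))
  positivity

theorem roundMetric_smul (γ : Γ.group) (x : Γ.Omega) (a : TangentSpace (𝓡 n) x) :
    Γ.roundMetric (γ • x) (mfderiv (𝓡 n) (𝓡 n) (fun y : Γ.Omega => γ • y) x a)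
      (mfderiv (𝓡 n) (𝓡 n) (fun y : Γ.Omega => γ • y) x a) =
      Γ.factor γ x ^ 2 * Γ.roundMetric x a a := by
  have h1 : mvfderiv (𝓡 n) Γ.incl (γ • x)
      (mfderiv (𝓡 n) (𝓡 n) (fun y : Γ.Omega => γ • y) x a) =
      mvfderiv (𝓡 n) (Γ.incl ∘ fun y : Γ.Omega => γ • y) x a :=
    (mvfderiv_comp_eq (mdifferentiableAt_incl _) (mdifferentiableAt_smul γ x) a).symm
  have h2 : ‖mvfderiv (𝓡 n) (Γ.incl ∘ fun y : Γ.Omega => γ • y) x a‖ =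
      Γ.factor γ x * ‖mvfderiv (𝓡 n) Γ.incl x a‖ := by
    refine norm_mvfderiv_eq_of_norm_sub_sq (j := fun y : Γ.Omega => Γ.factor γ y)
      (mdifferentiableAt_incl x)
      ((mdifferentiableAt_incl (γ • x)).comp x (mdifferentiableAt_smul γ x))
      ((continuous_factor γ).comp continuous_subtype_val).continuousAt (factor_pos γ x).le
      (fun y => ?_) a
    simp only [Function.comp_apply, norm_incl_sub, coe_smul]
    exact dist_apply_sq γ y x
  rw [roundMetric, roundMetric, real_inner_self_eq_norm_sq, real_inner_self_eq_norm_sq, h1, h2,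
    mul_pow]

theorem pullback_smul (g : Γ.RiemannianMetric) (γ : Γ.group) (x : Γ.Omega)
    (a b : TangentSpace (𝓡 n) x) :
    Γ.pullback g (γ • x) (mfderiv (𝓡 n) (𝓡 n) (fun y : Γ.Omega => γ • y) x a)
      (mfderiv (𝓡 n) (𝓡 n) (fun y : Γ.Omega => γ • y) x b) = Γ.pullback g x a b := by
  have hp : MDifferentiableAt (𝓡 n) (𝓡 n) Γ.proj (γ • x) :=
    (Γ.contMDiff_proj _).mdifferentiableAt (by simp)
  have hc := mfderiv_comp x hp (mdifferentiableAt_smul γ x)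
  have h1 : ∀ v, mfderiv (𝓡 n) (𝓡 n) Γ.proj (γ • x)
      (mfderiv (𝓡 n) (𝓡 n) (fun y : Γ.Omega => γ • y) x v) =
      mfderiv (𝓡 n) (𝓡 n) (Γ.proj ∘ fun y : Γ.Omega => γ • y) x v := fun v => by
    rw [hc]
    rfl
  have h2 : (Γ.proj ∘ fun y : Γ.Omega => γ • y) = Γ.proj :=
    funext fun y => Γ.isQuotientCoveringMap_proj.map_smul γ
  rw [pullback, h1, h1]
  -- Base point and derivative both depend on the map, so the equality of maps is applied to the
  -- whole expression.
  exact congrArg (fun F : Γ.Omega → Γ.Manifold =>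
    g.inner (F x) (mfderiv (𝓡 n) (𝓡 n) F x a) (mfderiv (𝓡 n) (𝓡 n) F x b)) h2

theorem eq_of_conformalMetric_eq (hn : 1 ≤ n) {u w : Γ.Omega → ℝ} {x : Γ.Omega}
    (h : ∀ a b, Γ.conformalMetric u x a b = Γ.conformalMetric w x a b) : u x = w x := by
  obtain ⟨a, ha⟩ := exists_roundMetric_pos hn x
  have h1 := Real.exp_injective (mul_right_cancel₀ ha.ne' (h a a))
  linarith

theorem IsLift.unique (hn : 1 ≤ n) {g : Γ.RiemannianMetric} {u w : Γ.Omega → ℝ}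
    (hu : Γ.IsLift g u) (hw : Γ.IsLift g w) : u = w :=
  funext fun x => eq_of_conformalMetric_eq hn fun a b => (hu x a b).symm.trans (hw x a b)

/-- The metric determines the exponent at each point, so the local exponents agree on overlaps, and
the diagonal choice coincides near each point with one smooth exponent. -/
theorem IsConformal.exists_isLift (hn : 1 ≤ n) {g : Γ.RiemannianMetric} (hg : Γ.IsConformal g) :
    ∃ u : Γ.Omega → ℝ, ContMDiff (𝓡 n) 𝓘(ℝ) ∞ u ∧ Γ.IsLift g u := by
  choose U hU w hw hgw using hg
  refine ⟨fun x => w x x, fun x => ?_, fun x a b => hgw x x (mem_of_mem_nhds (hU x)) a b⟩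
  refine ((hw x).contMDiffAt (hU x)).congr_of_eventuallyEq ?_
  filter_upwards [hU x] with y hy
  exact eq_of_conformalMetric_eq (u := w y) hn fun a b =>
    (hgw y y (mem_of_mem_nhds (hU y)) a b).symm.trans (hgw x y hy a b)

theorem IsLift.isInvariantMetric {g : Γ.RiemannianMetric} {u : Γ.Omega → ℝ} (hu : Γ.IsLift g u) :
    Γ.IsInvariantMetric u := fun γ x a b => by
  rw [← hu, ← hu, pullback_smul]

/-- γ multiplies g₀ by the square of its factor, so invariance tested on one vector is the square of
this relation. -/
theorem IsLift.exp_smul_mul_factor (hn : 1 ≤ n) {g : Γ.RiemannianMetric} {u : Γ.Omega → ℝ}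
    (hu : Γ.IsLift g u) (γ : Γ.group) (x : Γ.Omega) :
    Real.exp (u (γ • x)) * Γ.factor γ x = Real.exp (u x) := by
  obtain ⟨a, ha⟩ := exists_roundMetric_pos hn x
  have h1 := hu.isInvariantMetric γ x a a
  rw [conformalMetric, conformalMetric, roundMetric_smul, ← mul_assoc] at h1
  have h2 := mul_right_cancel₀ ha.ne' h1
  have h3 := (factor_pos γ x.1).le
  refine (pow_left_inj₀ (by positivity) (Real.exp_pos _).le two_ne_zero).1 ?_
  rw [mul_pow, ← Real.exp_nat_mul, ← Real.exp_nat_mul]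
  exact_mod_cast h2

/-- The conformal factor of an invariant metric is comparable with the inverse of the distance to
the limit set. -/
theorem IsLift.exists_comparable (hne : Γ.IsNonelementary) (hcpt : CompactSpace Γ.Manifold)
    {g : Γ.RiemannianMetric} {u : Γ.Omega → ℝ} (hu : Γ.IsLift g u) (huc : Continuous u) :
    ∃ K > 0, ∀ x : Γ.Omega, Γ.gap x * Real.exp (u x) ≤ K ∧
      1 ≤ K * Γ.gap x * Real.exp (u x) := by
  obtain ⟨D, hD, hDx⟩ := exists_compact_fundamental hcpt
  obtain ⟨C, hC, h⟩ := exists_factor_comparable_of_isCompact hne hD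
  obtain ⟨B, hB⟩ := hD.exists_bound_of_continuousOn huc.continuousOn
  refine ⟨C * Real.exp B, by positivity, fun x => ?_⟩
  obtain ⟨γ, d, hd, rfl⟩ := hDx x
  obtain ⟨h1, h2⟩ := h γ d hd
  have h3 := hu.exp_smul_mul_factor hne.one_le γ d
  have h4 := abs_le.1 (hB d hd)
  have h5 := Real.exp_pos (u (γ • d))
  rw [coe_smul]
  constructor
  · calc Γ.gap (γ.1 d) * Real.exp (u (γ • d)) ≤ C * Γ.factor γ d * Real.exp (u (γ • d)) := by gcongr
      _ = C * Real.exp (u d) := by rw [← h3]; ring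
      _ ≤ C * Real.exp B := by gcongr; exact h4.2
  · calc 1 = Real.exp B * Real.exp (-B) := by rw [← Real.exp_add]; simp
      _ ≤ Real.exp B * Real.exp (u d) := by gcongr; exact h4.1
      _ = Real.exp B * (Real.exp (u (γ • d)) * Γ.factor γ d) := by rw [h3]
      _ ≤ Real.exp B * (Real.exp (u (γ • d)) * (C * Γ.gap (γ.1 d))) := by gcongr
      _ = _ := by ring

end KleinianGroup

/-! ### The radial graph and its intrinsic metric -/

namespace KleinianGroup.IsAdmissible

variable {n : ℕ} {Γ : KleinianGroup n} {C ε : ℝ}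

/-- The radial parametrization of the graph. -/
noncomputable def radialMap (h : Γ.IsAdmissible C ε) (x : Γ.Omega) : Γ.graph ε :=
  ⟨Γ.radius ε x • Γ.incl x, h.radius_smul_mem_graph x⟩

variable (h : Γ.IsAdmissible C ε)

include h

theorem norm_radialMap (x : Γ.Omega) : ‖(h.radialMap x : ESpace n)‖ = Γ.radius ε x :=
  h.norm_radius_smul x

/-- Radial projection inverts `radialMap`, and on vectors of norm at least 1/4 it has Lipschitz
constant 2/(1/4) = 8. -/
theorem norm_incl_sub_le (x y : Γ.Omega) :
    ‖Γ.incl x - Γ.incl y‖ ≤ 8 * ‖(h.radialMap x : ESpace n) - h.radialMap y‖ := by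
  have e : ∀ x, ‖(h.radialMap x : ESpace n)‖⁻¹ • (h.radialMap x : ESpace n) = Γ.incl x := by
    intro x
    have := h.quarter_le_radius x
    rw [h.norm_radialMap, radialMap, smul_smul, inv_mul_cancel₀ (by linarith), one_smul]
  have hx : 1 / 4 ≤ ‖(h.radialMap x : ESpace n)‖ := by
    rw [h.norm_radialMap]
    exact h.quarter_le_radius x
  have hy : (h.radialMap y : ESpace n) ≠ 0 := by
    rw [← norm_pos_iff, h.norm_radialMap]
    linarith [h.quarter_le_radius y]
  have h1 := norm_normalize_sub_le (by norm_num) hx hy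
  rw [e, e] at h1
  norm_num at h1
  exact h1

theorem bijective_radialMap : Function.Bijective h.radialMap := by
  refine ⟨fun x y hxy => ?_, fun z => ?_⟩
  · have h1 := h.norm_incl_sub_le x y
    rw [hxy, sub_self, norm_zero, mul_zero, norm_incl_sub] at h1
    exact Subtype.ext (dist_le_zero.1 h1)
  · obtain ⟨x, hx⟩ := h.exists_radius_smul_eq z.2
    exact ⟨x, Subtype.ext hx⟩

theorem norm_radialMap_sub_le (x y : Γ.Omega) :
    ‖(h.radialMap x : ESpace n) - h.radialMap y‖ ≤ (18 * C + 1) * ‖Γ.incl x - Γ.incl y‖ := by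
  have e : (h.radialMap x : ESpace n) - h.radialMap y =
      (Γ.radius ε x - Γ.radius ε y) • Γ.incl x + Γ.radius ε y • (Γ.incl x - Γ.incl y) := by
    simp only [radialMap]
    module
  have h1 := h.abs_radius_sub_le x y
  have h2 := h.quarter_le_radius y
  have h3 := h.radius_lt_one y
  rw [e]
  refine (norm_add_le _ _).trans ?_
  rw [norm_smul, norm_smul, norm_incl, mul_one, Real.norm_eq_abs,
    Real.norm_of_nonneg (by linarith : 0 ≤ Γ.radius ε y), norm_incl_sub]
  nlinarith [dist_nonneg (x := x.1) (y := y.1)]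

/-- `radialMap` and its inverse are Lipschitz for Euclidean distances, and both length densities are
comparable with the inverse of the gap, so `lengthEDist_map_le` applies in each direction. -/
theorem exists_bilipschitz {u : Γ.Omega → ℝ} {K : ℝ} (hK : 0 < K)
    (hu : ∀ x : Γ.Omega, Γ.gap x * Real.exp (u x) ≤ K ∧ 1 ≤ K * Γ.gap x * Real.exp (u x)) :
    ∃ Λ : ℝ≥0, 0 < Λ ∧ ∀ x y : Γ.Omega,
      Γ.graphEDist ε (h.radialMap x) (h.radialMap y) ≤ Λ * Γ.conformalEDist u x y ∧
        Γ.conformalEDist u x y ≤ Λ * Γ.graphEDist ε (h.radialMap x) (h.radialMap y) := by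
  have hC := h.one_le
  have hε := h.pos
  have hpos : ∀ x, 0 < 1 - Γ.radius ε x ^ 2 := fun x => by
    nlinarith [h.radius_lt_one x, h.quarter_le_radius x]
  set e : Γ.Omega ≃ Γ.graph ε := Equiv.ofBijective h.radialMap h.bijective_radialMap with he
  have hee : ∀ x, e x = h.radialMap x := fun _ => rfl
  set L₁ : ℝ≥0 := (18 * C + 1).toNNReal with hL₁
  set A₁ : ℝ≥0 := (4 * K / ε).toNNReal with hA₁
  set A₂ : ℝ≥0 := K.toNNReal with hA₂
  have hL₁p : 0 < L₁ := Real.toNNReal_pos.2 (by linarith)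
  have hA₁p : 0 < A₁ := Real.toNNReal_pos.2 (by positivity)
  have hA₂p : 0 < A₂ := Real.toNNReal_pos.2 hK
  have H₁ : ∀ x y : Γ.Omega, Γ.graphEDist ε (h.radialMap x) (h.radialMap y) ≤
      (A₁ * L₁ : ℝ≥0) * Γ.conformalEDist u x y := by
    refine lengthEDist_map_le h.radialMap hL₁p hA₁p (fun x y => ?_) (fun x => ?_)
      fun x => (Real.exp_pos _).le
    · rw [hL₁, Real.coe_toNNReal _ (by linarith)]
      exact h.norm_radialMap_sub_le x y
    · rw [hA₁, Real.coe_toNNReal _ (by positivity), h.norm_radialMap, div_le_iff₀ (hpos x)]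
      have h1 := h.mul_gap_le_one_sub_radius_sq x
      have h2 := (hu x).2
      calc (2 : ℝ) ≤ 2 * (K * Γ.gap x * Real.exp (u x)) := by linarith
        _ = 4 * K / ε * Real.exp (u x) * (ε / 2 * Γ.gap x) := by field_simp; ring
        _ ≤ 4 * K / ε * Real.exp (u x) * (1 - Γ.radius ε x ^ 2) := by gcongr
  have H₂ : ∀ z w : Γ.graph ε, Γ.conformalEDist u (e.symm z) (e.symm w) ≤
      (A₂ * 8 : ℝ≥0) * Γ.graphEDist ε z w := by
    refine lengthEDist_map_le e.symm (by norm_num) hA₂p (fun z w => ?_) (fun z => ?_) fun z => ?_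
    · obtain ⟨x, rfl⟩ := e.surjective z
      obtain ⟨y, rfl⟩ := e.surjective w
      rw [e.symm_apply_apply, e.symm_apply_apply]
      exact h.norm_incl_sub_le x y
    · obtain ⟨x, rfl⟩ := e.surjective z
      rw [e.symm_apply_apply, hA₂, Real.coe_toNNReal _ hK.le, hee, h.norm_radialMap, ← mul_div_assoc,
        le_div_iff₀ (hpos x)]
      have h1 := h.one_sub_radius_sq_le x
      have h2 : 1 - Γ.radius ε x ^ 2 ≤ Γ.gap x := by
        nlinarith [h.le, Γ.gap_nonneg x.1]
      calc Real.exp (u x) * (1 - Γ.radius ε x ^ 2) ≤ Real.exp (u x) * Γ.gap x := by gcongr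
        _ ≤ K * 2 := by linarith [(hu x).1]
    · obtain ⟨x, rfl⟩ := e.surjective z
      rw [hee, h.norm_radialMap]
      have := hpos x
      positivity
  refine ⟨max (A₁ * L₁) (A₂ * 8), lt_max_of_lt_left (mul_pos hA₁p hL₁p), fun x y => ⟨?_, ?_⟩⟩
  · refine (H₁ x y).trans ?_
    gcongr
    exact le_max_left _ _
  · have h1 := H₂ (e x) (e y)
    rw [e.symm_apply_apply, e.symm_apply_apply] at h1
    refine h1.trans ?_
    rw [hee, hee]
    gcongr
    exact le_max_right _ _

end KleinianGroup.IsAdmissible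

theorem theorem2p1 (n : ℕ) (Γ : KleinianGroup n) (hne : Γ.IsNonelementary)
    (hcpt : CompactSpace Γ.Manifold) :
    (∀ g : Γ.RiemannianMetric, Γ.IsConformal g →
      ∃ u : Γ.Omega → ℝ, ContMDiff (𝓡 n) 𝓘(ℝ) ∞ u ∧ Γ.IsLift g u ∧
        Γ.IsInvariantMetric u ∧ Γ.IsCompleteMetric u ∧
        ∃ K : ℝ, 0 < K ∧ ∀ x : Γ.Omega,
          1 / K * (1 / Γ.distLimit x) ≤ Real.exp (u x) ∧
            Real.exp (u x) ≤ K * (1 / Γ.distLimit x)) ∧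
    ∃ ε₀ : ℝ, 0 < ε₀ ∧ ∀ ε : ℝ, 0 < ε → ε < ε₀ →
      (∀ γ ∈ Γ.group, ∀ τ, IsPoincareExtension γ τ →
        (fun z => (τ z : ESpace n)) '' {z | (z : ESpace n) ∈ Γ.graph ε} = Γ.graph ε) ∧
      ∃ (f : Γ.Omega → ℝ) (F : Γ.Omega → Γ.graph ε),
        (∀ x, 0 < f x ∧ f x < 1) ∧
        (∃ M : ℝ, ∀ x y : Γ.Omega, |f x - f y| ≤ M * sphereDist (x : USphere n) y) ∧
        (∀ x, (F x : ESpace n) = f x • Γ.incl x) ∧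
        Function.Bijective F ∧
        ∀ (g : Γ.RiemannianMetric) (u : Γ.Omega → ℝ), Γ.IsConformal g → Γ.IsLift g u →
          ∃ Λ : ℝ≥0, 0 < Λ ∧ ∀ x y : Γ.Omega,
            Γ.graphEDist ε (F x) (F y) ≤ Λ * Γ.conformalEDist u x y ∧
              Γ.conformalEDist u x y ≤ Λ * Γ.graphEDist ε (F x) (F y) := by
  have hn := hne.one_le
  refine ⟨fun g hg => ?_, ?_⟩
  · obtain ⟨u, hus, hu⟩ := hg.exists_isLift hn
    obtain ⟨K, hK, hKu⟩ := hu.exists_comparable hne hcpt hus.continuous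
    refine ⟨u, hus, hu, hu.isInvariantMetric,
      KleinianGroup.isCompleteMetric_of_comparable hne (fun x => (hKu x).2) fun x => (hKu x).1,
      -- The factor 2 passes from the chordal gap to the angular `distLimit`.
      2 * K, by positivity, fun x => ?_⟩
    have hd := KleinianGroup.distLimit_pos hne x
    have h1 := KleinianGroup.gap_le_distLimit hne x
    have h2 := KleinianGroup.distLimit_le_two_mul_gap hne x
    obtain ⟨h3, h4⟩ := hKu x
    have hexp := Real.exp_pos (u x)
    constructor
    · rw [one_div_mul_one_div, div_le_iff₀ (by positivity)]
      have h5 : K * Γ.gap x * Real.exp (u x) ≤ K * Γ.distLimit x * Real.exp (u x) := by gcongr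
      linarith
    · rw [mul_one_div, le_div_iff₀ hd]
      have h5 : Real.exp (u x) * Γ.distLimit x ≤ Real.exp (u x) * (2 * Γ.gap x) := by gcongr
      linarith
  · obtain ⟨C, ε₀, hε₀, hadm⟩ := KleinianGroup.exists_isAdmissible hne hcpt
    refine ⟨ε₀, hε₀, fun ε hε hε' => ⟨fun γ hγ τ hτ => ?_, ?_⟩⟩
    · exact KleinianGroup.image_graph ⟨γ, hγ⟩ hτ ε
    have h := hadm ε hε hε'
    refine ⟨Γ.radius ε, h.radialMap,
      fun x => ⟨by linarith [h.quarter_le_radius x], h.radius_lt_one x⟩,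
      ⟨18 * C, fun x y => (h.abs_radius_sub_le x y).trans ?_⟩, fun _ => rfl, h.bijective_radialMap,
      fun g u hg hu => ?_⟩
    · have := h.one_le
      gcongr
      exact dist_le_sphereDist _ _
    -- The given exponent u is not assumed continuous; uniqueness of the lift identifies it with the
    -- smooth one, to which the compactness argument applies.
    · obtain ⟨w, hws, hw⟩ := hg.exists_isLift hn
      obtain rfl := hu.unique hn hw
      obtain ⟨K, hK, hKu⟩ := hu.exists_comparable hne hcpt hws.continuous
      exact h.exists_bilipschitz hK hKu
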